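/- \textbf{Definitions.} An \emph{inverse monoid} is a monoid $S$ in which every $s$ has a unique $s^{-1}$ with $s=ss^{-1}s$ and $s^{-1}=s^{-1}ss^{-1}$; its natural partial order is $a\le b \iff a=ba^{-1}a$. Write $\mathsf{E}(S)$ for the set of idempotents, $\mathsf{U}(S)$ for the group of units, $\mathbf{d}(a)=a^{-1}a$, $\mathbf{r}(a)=aa^{-1}$; and $s\sim t$ (compatible) if $s^{-1}t$ and $st^{-1}$ are idempotents. Joins, meets and complements below are with respect to the natural partial order. An inverse monoid with zero is \emph{Boolean} if $\mathsf{E}(S)$ is a Boolean algebra, every compatible pair of elements has a join, and multiplication distributes over such joins. A \emph{Tarski monoid} is a countably infinite Boolean inverse monoid in which every pair of elements has a meet. It is \emph{simple} if it is \emph{fundamental} (every element commuting with all idempotents is an idempotent) and \emph{$0$-simplifying} (the only ideals $I$ that coincide with the set of joins of finite compatible subsets of $I$ are $\{0\}$ and $S$). A \emph{special involution} is a unit $g\neq 1$ of the form $g=a^{-1}\vee a\vee \overline{\mathbf{d}(a)\vee\mathbf{r}(a)}$ with $a^2=0$, the bar denoting the complement in $\mathsf{E}(S)$; $\mathsf{Sym}(S)$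 is the subgroup of $\mathsf{U}(S)$ generated by the special involutions. The \emph{structure space} $\mathsf{X}(S)$ is the set of ultrafilters of $\mathsf{E}(S)$ with the topology generated by the sets $U_e=\{F : e\in F\}$, $e\in\mathsf{E}(S)$; units act on it by $gFg^{-1}=\{geg^{-1} : e\in F\}$. \textbf{Proposition.} Let $S$ and $T$ be simple Tarski monoids, let $G\le\mathsf{U}(S)$ be a subgroup containing $\mathsf{Sym}(S)$, let $H\le\mathsf{U}(T)$ be a subgroup containing $\mathsf{Sym}(T)$, and let $\alpha\colon G\to H$ be an isomorphism of groups. Then there exists a homeomorphism $\beta\colon\mathsf{X}(S)\to\mathsf{X}(T)$ such that $$\beta(gFg^{-1})=\alpha(g)\,\beta(F)\,\alpha(g)^{-1}\qquad\text{for every } F\in\mathsf{X}(S) \text{ and } g\in G.$$ -/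

import Mathlib

universe u

/-- An inverse monoid with zero: every `s` has a unique `s⁻¹` with `s = s s⁻¹ s` and
`s⁻¹ = s⁻¹ s s⁻¹`. -/
class InverseMonoidWithZero (S : Type u) extends MonoidWithZero S, Inv S where
  mul_inv_mul : ∀ s : S, s * s⁻¹ * s = s
  inv_mul_inv : ∀ s : S, s⁻¹ * s * s⁻¹ = s⁻¹
  inv_unique : ∀ s t : S, s * t * s = s → t * s * t = t → t = s⁻¹

namespace InverseMonoidWithZero

variable {S : Type u} [InverseMonoidWithZero S]

theorem inv_of_idem {e : S} (he : e * e = e) : e⁻¹ = e :=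
  (inv_unique e e (by rw [he, he]) (by rw [he, he])).symm

theorem idem_mul_idem {e f : S} (he : e * e = e) (hf : f * f = f) :
    (e * f) * (e * f) = e * f := by
  set x := (e * f)⁻¹ with hx
  have h1 : (e * f) * x * (e * f) = e * f := mul_inv_mul _
  have h2 : x * (e * f) * x = x := inv_mul_inv _
  have h3 : f * x * e = x := by
    refine inv_unique (e * f) (f * x * e) ?_ ?_
    · calc (e * f) * (f * x * e) * (e * f)
          = e * (f * f) * x * (e * e) * f := by simp only [mul_assoc]
        _ = (e * f) * x * (e * f) := by rw [he, hf]; simp only [mul_assoc]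
        _ = e * f := h1
    · calc (f * x * e) * (e * f) * (f * x * e)
          = f * x * (e * e) * (f * f) * x * e := by simp only [mul_assoc]
        _ = f * (x * (e * f) * x) * e := by rw [he, hf]; simp only [mul_assoc]
        _ = f * x * e := by rw [h2]
  have h4 : x * x = x := by
    calc x * x = (f * x * e) * (f * x * e) := by rw [h3]
      _ = f * (x * (e * f) * x) * e := by simp only [mul_assoc]
      _ = x := by rw [h2, h3]
  have h5 : e * f = x := by
    rw [inv_unique x (e * f) h2 h1, inv_of_idem h4]
  rw [h5, h4]

theorem idem_comm {e f : S} (he : e * e = e) (hf : f * f = f) : e * f = f * e := by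
  have hef := idem_mul_idem he hf
  have hfe := idem_mul_idem hf he
  have h : f * e = (e * f)⁻¹ := by
    refine inv_unique (e * f) (f * e) ?_ ?_
    · calc (e * f) * (f * e) * (e * f)
          = e * (f * f) * (e * e) * f := by simp only [mul_assoc]
        _ = (e * f) * (e * f) := by rw [he, hf]; simp only [mul_assoc]
        _ = e * f := hef
    · calc (f * e) * (e * f) * (f * e)
          = f * (e * e) * (f * f) * e := by simp only [mul_assoc]
        _ = (f * e) * (f * e) := by rw [he, hf]; simp only [mul_assoc]
        _ = f * e := hfe
  rw [h, inv_of_idem hef]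

theorem inv_mul_self_idem (a : S) : (a⁻¹ * a) * (a⁻¹ * a) = a⁻¹ * a := by
  rw [← mul_assoc, inv_mul_inv]

theorem mul_inv_self_idem (a : S) : (a * a⁻¹) * (a * a⁻¹) = a * a⁻¹ := by
  rw [← mul_assoc, mul_inv_mul]

theorem mul_dom_of_le {a b : S} (h : a = b * a⁻¹ * a) : a * (b⁻¹ * b) = a := by
  have hb : b * (b⁻¹ * b) = b := by rw [← mul_assoc, mul_inv_mul]
  calc a * (b⁻¹ * b) = b * (a⁻¹ * a) * (b⁻¹ * b) := by rw [← mul_assoc b, ← h]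
    _ = b * (b⁻¹ * b) * (a⁻¹ * a) := by
        rw [mul_assoc, idem_comm (inv_mul_self_idem a) (inv_mul_self_idem b), ← mul_assoc b]
    _ = a := by rw [hb, ← mul_assoc, ← h]

/-- The natural partial order. -/
instance instPartialOrder : PartialOrder S where
  le a b := a = b * a⁻¹ * a
  le_refl a := (mul_inv_mul a).symm
  le_trans a b c hab hbc := by
    have hd : (b⁻¹ * b) * (a⁻¹ * a) = a⁻¹ * a := by
      rw [idem_comm (inv_mul_self_idem b) (inv_mul_self_idem a), mul_assoc, mul_dom_of_le hab]
    change a = c * a⁻¹ * a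
    calc a = b * (a⁻¹ * a) := by rw [← mul_assoc, ← hab]
      _ = c * (b⁻¹ * b) * (a⁻¹ * a) := by rw [← mul_assoc c, ← hbc]
      _ = c * a⁻¹ * a := by rw [mul_assoc, hd, mul_assoc]
  le_antisymm a b hab hba := by
    calc a = a * (b⁻¹ * b) := (mul_dom_of_le hab).symm
      _ = b := by rw [← mul_assoc, ← hba]

theorem le_def (a b : S) : a ≤ b ↔ a = b * a⁻¹ * a := Iff.rfl

/-- `s ∼ t`: both `s⁻¹ t` and `s t⁻¹` are idempotent. -/
def Compatible (s t : S) : Prop :=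
  IsIdempotentElem (s⁻¹ * t) ∧ IsIdempotentElem (s * t⁻¹)

end InverseMonoidWithZero

open InverseMonoidWithZero

/-- The idempotents `E(S)`, ordered by the natural partial order of `S`. -/
def Idem (S : Type u) [InverseMonoidWithZero S] : Type u := {e : S // IsIdempotentElem e}

namespace Idem

variable {S : Type u} [InverseMonoidWithZero S]

instance : PartialOrder (Idem S) := Subtype.partialOrder _

theorem le_iff (e f : Idem S) : e ≤ f ↔ e.1 = f.1 * e.1 := by
  change e.1 = f.1 * e.1⁻¹ * e.1 ↔ _
  rw [inv_of_idem e.2, mul_assoc, e.2.eq]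

instance : BoundedOrder (Idem S) where
  top := ⟨1, one_mul 1⟩
  le_top e := (le_iff e _).2 (one_mul e.1).symm
  bot := ⟨0, mul_zero 0⟩
  bot_le e := (le_iff _ e).2 (mul_zero e.1).symm

/-- `d(a) = a⁻¹ a`. -/
def dom (a : S) : Idem S := ⟨a⁻¹ * a, inv_mul_self_idem a⟩

/-- `r(a) = a a⁻¹`. -/
def ran (a : S) : Idem S := ⟨a * a⁻¹, mul_inv_self_idem a⟩

/-- The natural action of the units on the idempotents, `e ↦ g e g⁻¹`. -/
def conj (g : Sˣ) (e : Idem S) : Idem S :=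
  ⟨(g : S) * e.1 * ((g⁻¹ : Sˣ) : S), by
    change (g : S) * e.1 * ((g⁻¹ : Sˣ) : S) * ((g : S) * e.1 * ((g⁻¹ : Sˣ) : S)) = _
    calc (g : S) * e.1 * ((g⁻¹ : Sˣ) : S) * ((g : S) * e.1 * ((g⁻¹ : Sˣ) : S))
        = (g : S) * e.1 * (((g⁻¹ : Sˣ) : S) * (g : S)) * e.1 * ((g⁻¹ : Sˣ) : S) := by
          simp only [mul_assoc]
      _ = (g : S) * e.1 * ((g⁻¹ : Sˣ) : S) := by
          rw [Units.inv_mul, mul_one, mul_assoc (g : S), e.2.eq]⟩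

theorem conj_conj_inv (g : Sˣ) (e : Idem S) : conj g (conj g⁻¹ e) = e := by
  apply Subtype.ext
  simp [conj, ← mul_assoc]

theorem conj_inv_conj (g : Sˣ) (e : Idem S) : conj g⁻¹ (conj g e) = e := by
  apply Subtype.ext
  simp [conj, ← mul_assoc]

theorem conj_mono (g : Sˣ) : Monotone (conj g : Idem S → Idem S) := by
  intro e f h
  rw [le_iff] at h ⊢
  change (g : S) * e.1 * ((g⁻¹ : Sˣ) : S)
    = ((g : S) * f.1 * ((g⁻¹ : Sˣ) : S)) * ((g : S) * e.1 * ((g⁻¹ : Sˣ) : S))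
  calc (g : S) * e.1 * ((g⁻¹ : Sˣ) : S)
      = (g : S) * (f.1 * e.1) * ((g⁻¹ : Sˣ) : S) := by rw [← h]
    _ = (g : S) * f.1 * (((g⁻¹ : Sˣ) : S) * (g : S)) * e.1 * ((g⁻¹ : Sˣ) : S) := by
        rw [Units.inv_mul, mul_one]; simp only [mul_assoc]
    _ = _ := by simp only [mul_assoc]

theorem conj_bot (g : Sˣ) : conj g (⊥ : Idem S) = ⊥ := by
  apply Subtype.ext
  change (g : S) * 0 * ((g⁻¹ : Sˣ) : S) = 0
  simp

/-- `g F g⁻¹ = {g e g⁻¹ : e ∈ F}` for a filter `F` of idempotents. -/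
def conjFilter (g : Sˣ) (F : Order.PFilter (Idem S)) : Order.PFilter (Idem S) :=
  Order.IsPFilter.toPFilter (F := conj g '' (F : Set (Idem S))) <|
    Order.IsPFilter.of_def (F.nonempty.image _)
      (by
        rintro _ ⟨e, he, rfl⟩ _ ⟨f, hf, rfl⟩
        obtain ⟨k, hk, hke, hkf⟩ := F.directed e he f hf
        exact ⟨conj g k, ⟨k, hk, rfl⟩, conj_mono g hke, conj_mono g hkf⟩)
      (by
        rintro _ y hy ⟨e, he, rfl⟩
        refine ⟨conj g⁻¹ y, Order.PFilter.mem_of_le ?_ he, conj_conj_inv g y⟩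
        have := conj_mono g⁻¹ hy
        rwa [conj_inv_conj] at this)

theorem mem_conjFilter (g : Sˣ) (F : Order.PFilter (Idem S)) (e : Idem S) :
    e ∈ conjFilter g F ↔ ∃ f ∈ F, conj g f = e := Iff.rfl

end Idem

/-- A Boolean inverse monoid: the idempotents form a Boolean algebra under the natural partial
order, compatible pairs have joins, and multiplication distributes over these joins. -/
class IsBooleanInverse (S : Type u) [InverseMonoidWithZero S] : Prop where
  boolean : ∃ B : BooleanAlgebra (Idem S), ∀ e f : Idem S, B.le e f ↔ e ≤ f
  exists_join : ∀ s t : S, Compatible s t → ∃ j, IsLUB {s, t} j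
  mul_join : ∀ s t j u : S, Compatible s t → IsLUB {s, t} j → IsLUB {u * s, u * t} (u * j)
  join_mul : ∀ s t j u : S, Compatible s t → IsLUB {s, t} j → IsLUB {s * u, t * u} (j * u)

/-- A Tarski monoid: a countably infinite Boolean inverse `∧`-monoid. -/
class IsTarski (S : Type u) [InverseMonoidWithZero S] : Prop extends IsBooleanInverse S where
  countable : Countable S
  infinite : Infinite S
  exists_meet : ∀ s t : S, ∃ m, IsGLB {s, t} m

/-- `X^∨`: all joins of finite compatible subsets of `X`. -/
def veeClosure {S : Type u} [InverseMonoidWithZero S] (X : Set S) : Set S :=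
  {j | ∃ Y : Set S, Y.Finite ∧ Y ⊆ X ∧ Y.Pairwise Compatible ∧ IsLUB Y j}

/-- A nonempty two-sided semigroup ideal. -/
def IsSemigroupIdeal {S : Type u} [InverseMonoidWithZero S] (I : Set S) : Prop :=
  I.Nonempty ∧ ∀ a ∈ I, ∀ s : S, s * a ∈ I ∧ a * s ∈ I

/-- No `∨`-closed ideals other than `{0}` and `S`. -/
def IsZeroSimplifying (S : Type u) [InverseMonoidWithZero S] : Prop :=
  ∀ I : Set S, IsSemigroupIdeal I → I = veeClosure I → I = {0} ∨ I = Set.univ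

/-- Only idempotents centralize all the idempotents. -/
def IsFundamental (S : Type u) [InverseMonoidWithZero S] : Prop :=
  ∀ a : S, (∀ e : S, IsIdempotentElem e → a * e = e * a) → IsIdempotentElem a

/-- A simple Tarski monoid: fundamental and `0`-simplifying. -/
class IsSimpleTarski (S : Type u) [InverseMonoidWithZero S] : Prop extends IsTarski S where
  fundamental : IsFundamental S
  zeroSimplifying : IsZeroSimplifying S

/-- A special involution: `g = a⁻¹ ∨ a ∨ c`, where `a² = 0` and `c` is the complement of the
extent `d(a) ∨ r(a)`. The clause `g ≠ 1` excludes only `a = 0`. -/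
def IsSpecialInvolution {S : Type u} [InverseMonoidWithZero S] (g : Sˣ) : Prop :=
  g ≠ 1 ∧ ∃ a : S, a * a = 0 ∧ ∃ e c : Idem S,
    IsLUB {Idem.dom a, Idem.ran a} e ∧ IsCompl e c ∧ IsLUB {a⁻¹, a, c.1} (g : S)

/-- `Sym(S)`, the subgroup of the group of units generated by the special involutions. -/
def SymGroup (S : Type u) [InverseMonoidWithZero S] : Subgroup Sˣ :=
  Subgroup.closure {g | IsSpecialInvolution g}

/-- The structure space `X(S)`: the ultrafilters (maximal proper filters) of `E(S)`. -/
def StructureSpace (S : Type u) [InverseMonoidWithZero S] : Type u :=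
  {F : Order.PFilter (Idem S) // Maximal (fun A : Order.PFilter (Idem S) => (⊥ : Idem S) ∉ A) F}

namespace StructureSpace

variable {S : Type u} [InverseMonoidWithZero S]

/-- The Stone topology, with basic open sets `U_e = {F : e ∈ F}`. -/
instance : TopologicalSpace (StructureSpace S) :=
  TopologicalSpace.generateFrom (Set.range fun e : Idem S => {F : StructureSpace S | e ∈ F.1})

/-- The natural action of the units on the structure space, `F ↦ g F g⁻¹`. -/
def conj (g : Sˣ) (F : StructureSpace S) : StructureSpace S :=
  ⟨Idem.conjFilter g F.1, by
    have key : ∀ (h : Sˣ) (A : Order.PFilter (Idem S)),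
        (⊥ : Idem S) ∉ A → (⊥ : Idem S) ∉ Idem.conjFilter h A := by
      rintro h A hA ⟨f, hf, hfe⟩
      apply hA
      have : Idem.conj h⁻¹ (Idem.conj h f) = Idem.conj h⁻¹ ⊥ := congrArg (Idem.conj h⁻¹) hfe
      rw [Idem.conj_inv_conj, Idem.conj_bot] at this
      rwa [this] at hf
    refine ⟨key g F.1 F.2.1, fun A hA hle x hx => ?_⟩
    have h1 : F.1 ≤ Idem.conjFilter g⁻¹ A := fun y hy =>
      ⟨Idem.conj g y, hle ⟨y, hy, rfl⟩, Idem.conj_inv_conj g y⟩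
    have h2 := F.2.2 (key g⁻¹ A hA) h1
    exact ⟨Idem.conj g⁻¹ x, h2 ⟨x, hx, rfl⟩, Idem.conj_conj_inv g x⟩⟩

end StructureSpace

/-! ### Abstract setting: group actions with supports -/

open scoped commutatorElement

/-! The action of `G` on the Boolean algebra of idempotents can be recovered from the group `G`
alone; dualizing gives the homeomorphism. The reconstruction is in the style of Rubin.

The abstract half concerns a group acting with supports. Disjointness of supports is approximated by
the purely group-theoretic `AlgDisjoint`: disjoint supports imply it (`algDisjoint_of_disjoint`),
and conversely it forces the support of `f` to be disjoint from that of `g ^ 12`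
(`disjoint_of_algDisjoint`). The loss of a twelfth power is harmless, because every nonzero element
bounds the support of some `g` with `g ^ 12 ≠ 1`. Hence inclusion of supports is a group-theoretic
relation (`supp_le_supp_iff`), and so are disjointness and finite covering. Since every element of
the algebra is a finite join of supports, a group isomorphism induces an order isomorphism, and it
is equivariant because conjugation translates supports (`exists_orderIso`).

The other half shows that `G` acts on the idempotents in this way (`isSupportedAction`). The support
of a unit `g` is the complement of `g ∧ 1`; fundamentality says that `g` fixes everything below `e`
only if `g e = e`. An element `c` with orthogonal domain and range yields a special involution
supported on `d(c) ∨ r(c)`. Because the monoid is `0`-simplifying, any idempotent is covered by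
finitely many ranges of elements with domain in a given nonzero idempotent; because there are no
atoms, an idempotent splits into two nonzero halves, each of which can be covered from the other. So
supports of elements of `Sym(S)` generate all idempotents under finite joins. -/

/-- An action of a group on a Boolean algebra in which every group element has a support, every
nonzero element bounds the support of an involution, and every element is a finite join of
supports. -/
structure IsSupportedAction {B G : Type*} [BooleanAlgebra B] [Group G] (ρ : G →* (B ≃o B))
    (σ : G → B) : Prop where
  fixes_iff : ∀ (g : G) (e : B), Disjoint e (σ g) ↔ ∀ x ≤ e, ρ g x = x
  eq_one : ∀ g : G, σ g = ⊥ → g = 1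
  exists_involution : ∀ e : B, e ≠ ⊥ → ∃ g : G, g ≠ 1 ∧ g * g = 1 ∧ σ g ≤ e
  exists_sup : ∀ e : B, ∃ s : Finset G, s.sup σ = e

/-- The group-theoretic substitute for disjointness of supports. -/
def AlgDisjoint {G : Type*} [Group G] (f g : G) : Prop :=
  ∀ h, ¬ Commute f h → ∃ f₁ f₂ : G, Commute f₁ g ∧ Commute f₂ g ∧
    ⁅f₁, ⁅f₂, h⁆⁆ ≠ 1 ∧ Commute ⁅f₁, ⁅f₂, h⁆⁆ g

theorem commute_map_equiv {G H : Type*} [Group G] [Group H] (α : G ≃* H) {a b : G} :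
    Commute (α a) (α b) ↔ Commute a b := by
  simp only [commute_iff_eq, ← map_mul, α.injective.eq_iff]

theorem AlgDisjoint.map_equiv {G H : Type*} [Group G] [Group H] (α : G ≃* H) {f g : G}
    (h : AlgDisjoint f g) : AlgDisjoint (α f) (α g) := by
  intro k hk
  obtain ⟨k, rfl⟩ := α.surjective k
  rw [commute_map_equiv] at hk
  obtain ⟨f₁, f₂, h₁, h₂, h₃, h₄⟩ := h k hk
  refine ⟨α f₁, α f₂, (commute_map_equiv α).2 h₁, (commute_map_equiv α).2 h₂, ?_, ?_⟩
  · rw [← map_commutatorElement, ← map_commutatorElement]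
    exact fun h => h₃ (α.injective (h.trans (map_one α).symm))
  · rw [← map_commutatorElement, ← map_commutatorElement]
    exact (commute_map_equiv α).2 h₄

theorem algDisjoint_map_equiv {G H : Type*} [Group G] [Group H] (α : G ≃* H) {f g : G} :
    AlgDisjoint (α f) (α g) ↔ AlgDisjoint f g :=
  ⟨fun h => by simpa using h.map_equiv α.symm, fun h => h.map_equiv α⟩

/-! ### Calculus of supports -/

namespace IsSupportedAction

variable {B G : Type*} [BooleanAlgebra B] [Group G] {ρ : G →* (B ≃o B)} {σ : G → B}

theorem supp_le_iff (h : IsSupportedAction ρ σ) (g : G) (e : B) :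
    σ g ≤ e ↔ ∀ x, Disjoint x e → ρ g x = x := by
  have h1 : σ g ≤ e ↔ Disjoint eᶜ (σ g) := by
    rw [disjoint_comm, disjoint_compl_right_iff]
  rw [h1, h.fixes_iff]
  simp only [le_compl_iff_disjoint_right]

theorem fix (h : IsSupportedAction ρ σ) {g : G} {x : B} (hx : Disjoint x (σ g)) : ρ g x = x :=
  (h.fixes_iff g x).1 hx x le_rfl

theorem supp_one (h : IsSupportedAction ρ σ) : σ 1 = ⊥ := by
  rw [← le_bot_iff, h.supp_le_iff]
  intro x _
  simp

theorem supp_ne_bot (h : IsSupportedAction ρ σ) {g : G} (hg : g ≠ 1) : σ g ≠ ⊥ :=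
  fun h0 => hg (h.eq_one g h0)

theorem apply_inv_apply (ρ : G →* (B ≃o B)) (g : G) (x : B) : ρ g (ρ g⁻¹ x) = x := by
  rw [← RelIso.mul_apply, ← map_mul]; simp

theorem inv_apply_apply (ρ : G →* (B ≃o B)) (g : G) (x : B) : ρ g⁻¹ (ρ g x) = x := by
  rw [← RelIso.mul_apply, ← map_mul]; simp

theorem mul_apply (ρ : G →* (B ≃o B)) (g k : G) (x : B) : ρ (g * k) x = ρ g (ρ k x) := by
  rw [map_mul, RelIso.mul_apply]

theorem disjoint_apply (ρ : G →* (B ≃o B)) (g : G) {x y : B} :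
    Disjoint (ρ g x) (ρ g y) ↔ Disjoint x y := disjoint_map_orderIso_iff (ρ g)

theorem eq_of_forall (h : IsSupportedAction ρ σ) {g k : G} (e : B)
    (h₁ : ∀ x ≤ e, ρ g x = ρ k x) (h₂ : ∀ x ≤ eᶜ, ρ g x = ρ k x) : g = k := by
  have key : ∀ x, ρ g x = ρ k x := by
    intro x
    have : x = (x ⊓ e) ⊔ (x ⊓ eᶜ) := by rw [← inf_sup_left, sup_compl_eq_top, inf_top_eq]
    rw [this, map_sup, map_sup, h₁ _ inf_le_right, h₂ _ inf_le_right]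
  have : k⁻¹ * g = 1 := by
    apply h.eq_one
    rw [← le_bot_iff, h.supp_le_iff]
    intro x _
    rw [mul_apply, key, inv_apply_apply]
  exact (inv_mul_eq_one.1 this).symm

/-- Some `x ≤ e` is not fixed, and the difference between `x` and a translate of it is the required
piece: `x \ g x` in general, and `x \ g⁻¹ x` when `x < g x` leaves the former empty. -/
theorem exists_moved (h : IsSupportedAction ρ σ) {g : G} {e : B} (he : ¬ Disjoint e (σ g)) :
    ∃ u, u ≠ ⊥ ∧ u ≤ e ∧ Disjoint u (ρ g u) := by
  rw [h.fixes_iff] at he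
  push Not at he
  obtain ⟨x, hx, hne⟩ := he
  by_cases hle : x ≤ ρ g x
  · have hle' : ρ g⁻¹ x ≤ x := by
      have := (ρ g⁻¹).monotone hle
      rwa [inv_apply_apply] at this
    refine ⟨x \ ρ g⁻¹ x, ?_, sdiff_le.trans hx, ?_⟩
    · rw [Ne, sdiff_eq_bot_iff]
      intro h2
      apply hne
      have := (ρ g).monotone h2
      rw [apply_inv_apply] at this
      exact le_antisymm this hle
    · rw [map_sdiff, apply_inv_apply]
      exact disjoint_sdiff_self_right.mono_left sdiff_le
  · refine ⟨x \ ρ g x, by rwa [Ne, sdiff_eq_bot_iff], sdiff_le.trans hx, ?_⟩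
    exact disjoint_sdiff_self_left.mono_right ((ρ g).monotone sdiff_le)

theorem supp_conj (h : IsSupportedAction ρ σ) (k g : G) : σ (k * g * k⁻¹) = ρ k (σ g) := by
  refine eq_of_forall_ge_iff fun e => ?_
  rw [h.supp_le_iff, ← (ρ k⁻¹).le_iff_le, inv_apply_apply, h.supp_le_iff]
  constructor
  · intro H x hx
    have := H (ρ k x) (by rwa [← disjoint_apply ρ k⁻¹, inv_apply_apply])
    rw [mul_apply, mul_apply, inv_apply_apply] at this
    exact (ρ k).injective this
  · intro H x hx
    rw [mul_apply, mul_apply, H _ (by rwa [disjoint_apply]), apply_inv_apply]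

theorem supp_mul_le (h : IsSupportedAction ρ σ) {g k : G} {e : B} (hg : σ g ≤ e)
    (hk : σ k ≤ e) : σ (g * k) ≤ e := by
  rw [h.supp_le_iff] at *
  intro x hx
  rw [mul_apply, hk x hx, hg x hx]

theorem supp_inv_le (h : IsSupportedAction ρ σ) {g : G} {e : B} (hg : σ g ≤ e) :
    σ g⁻¹ ≤ e := by
  rw [h.supp_le_iff] at *
  intro x hx
  conv_lhs => rw [← hg x hx]
  rw [inv_apply_apply]

theorem supp_pow_le (h : IsSupportedAction ρ σ) {g : G} {e : B} (hg : σ g ≤ e) (n : ℕ) :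
    σ (g ^ n) ≤ e := by
  induction n with
  | zero => rw [pow_zero, h.supp_one]; exact bot_le
  | succ n ih => rw [pow_succ]; exact h.supp_mul_le ih hg

theorem apply_supp_of_commute (h : IsSupportedAction ρ σ) {g k : G} (hc : Commute k g) :
    ρ k (σ g) = σ g := by
  rw [← h.supp_conj, hc.eq, mul_inv_cancel_right]

theorem commute_of_disjoint (h : IsSupportedAction ρ σ) {g k : G}
    (hd : Disjoint (σ g) (σ k)) : Commute g k := by
  have hgg : ρ g (σ g) = σ g := h.apply_supp_of_commute (Commute.refl g)
  refine h.eq_of_forall (σ g) (fun x hx => ?_) (fun x hx => ?_)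
  · rw [mul_apply, mul_apply, h.fix (g := k) (hd.mono_left hx), h.fix (g := k)]
    exact hd.mono_left (((ρ g).monotone hx).trans hgg.le)
  · have hx' : Disjoint x (σ g) := le_compl_iff_disjoint_right.1 hx
    rw [mul_apply, mul_apply, h.fix hx', h.fix]
    rw [← h.fix hd, disjoint_apply]
    exact hx'

/-- An element commuting with `k` preserves the support of `k`, whereas `f` moves it off itself. -/
theorem not_commute (h : IsSupportedAction ρ σ) {f k : G} {u : B} (hu : Disjoint u (ρ f u))
    (hk : σ k ≤ u) (hk1 : k ≠ 1) : ¬ Commute f k := by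
  intro hc
  refine h.supp_ne_bot hk1 (disjoint_self.1 (hu.mono hk ?_))
  rw [← h.apply_supp_of_commute hc]
  exact (ρ f).monotone hk

theorem exists_not_commute (h : IsSupportedAction ρ σ) {e : B} (he : e ≠ ⊥) :
    ∃ g k : G, σ g ≤ e ∧ σ k ≤ e ∧ ¬ Commute g k := by
  obtain ⟨g, hg1, -, hge⟩ := h.exists_involution e he
  obtain ⟨v, hv0, hve, hvd⟩ := h.exists_moved (g := g) (e := σ g)
    (by rw [disjoint_self]; exact h.supp_ne_bot hg1)
  obtain ⟨k, hk1, -, hkv⟩ := h.exists_involution v hv0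
  exact ⟨g, k, hge, hkv.trans (hve.trans hge), h.not_commute hvd hkv hk1⟩

/-! ### Algebraic disjointness versus disjoint supports -/

/-- If `k` does not commute with `f`, it moves some nonzero `u` below the support of `f` off itself.
Noncommuting `f₁`, `f₂` supported in `u` serve as witnesses: their double commutator with `k`
collapses to `⁅f₁, f₂⁆`, which lives in `u`, away from the support of `g`. -/
theorem algDisjoint_of_disjoint (h : IsSupportedAction ρ σ) {f g : G}
    (hfg : Disjoint (σ f) (σ g)) : AlgDisjoint f g := by
  intro k hk
  obtain ⟨u, hu0, huf, hud⟩ := h.exists_moved (g := k) (e := σ f)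
    (fun hd => hk (h.commute_of_disjoint hd))
  obtain ⟨f₁, f₂, h₁, h₂, hc⟩ := h.exists_not_commute hu0
  have hcomm : ⁅f₁, ⁅f₂, k⁆⁆ = ⁅f₁, f₂⁆ := by
    -- The factor of `⁅f₂, k⁆` that involves `k` is supported in `k u`, disjoint from `u`, so it
    -- drops out of the outer commutator.
    have hm : Commute f₁ (k * f₂⁻¹ * k⁻¹) := by
      apply h.commute_of_disjoint
      rw [h.supp_conj]
      exact hud.mono h₁ ((ρ k).monotone (h.supp_inv_le h₂))
    have hm' := hm.inv_left
    set m := k * f₂⁻¹ * k⁻¹ with hmdef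
    have h2 : ⁅f₂, k⁆ = f₂ * m := by rw [commutatorElement_def, hmdef]; group
    rw [h2, commutatorElement_def, commutatorElement_def]
    calc f₁ * (f₂ * m) * f₁⁻¹ * (f₂ * m)⁻¹ = f₁ * f₂ * (m * f₁⁻¹) * m⁻¹ * f₂⁻¹ := by group
      _ = f₁ * f₂ * (f₁⁻¹ * m) * m⁻¹ * f₂⁻¹ := by rw [hm'.eq]
      _ = _ := by group
  have hsup : ∀ {a : G}, σ a ≤ u → Commute a g := fun ha =>
    h.commute_of_disjoint (hfg.mono_left (ha.trans huf))
  refine ⟨f₁, f₂, hsup h₁, hsup h₂, ?_, ?_⟩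
  · rw [hcomm, Ne, commutatorElement_eq_one_iff_commute]
    exact hc
  · rw [hcomm]
    apply hsup
    rw [commutatorElement_def]
    exact h.supp_mul_le (h.supp_mul_le (h.supp_mul_le h₁ h₂) (h.supp_inv_le h₁))
      (h.supp_inv_le h₂)

theorem supp_commutator_le (h : IsSupportedAction ρ σ) {a b : G} {e : B} (hb : σ b ≤ e) :
    σ ⁅a, b⁆ ≤ ρ a e ⊔ e := by
  rw [commutatorElement_def]
  refine h.supp_mul_le ?_ ((h.supp_inv_le hb).trans le_sup_right)
  rw [h.supp_conj]
  exact ((ρ a).monotone hb).trans le_sup_left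

/-- Since `w` is `g`-invariant, each translate of `x` stays covered by the `V j`. At each stage, cut
the current translate by some `V j` that it meets and pull the piece back. -/
theorem exists_itinerary {ι : Type*} [Fintype ι] (ρ : G →* (B ≃o B)) {g : G} {w : B}
    (hw : w ≠ ⊥) (hgw : ρ g w = w) (V : ι → B) (hV : w ≤ Finset.univ.sup V) (n : ℕ) :
    ∃ x, x ≠ ⊥ ∧ x ≤ w ∧ ∃ j : ℕ → ι, ∀ i < n, ρ (g ^ i) x ≤ V (j i) := by
  have hpow : ∀ n : ℕ, ρ (g ^ n) w = w := by
    intro n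
    induction n with
    | zero => simp
    | succ n ih => rw [pow_succ, mul_apply, hgw, ih]
  have step : ∀ y, y ≠ ⊥ → y ≤ w → ∃ j, y ⊓ V j ≠ ⊥ := by
    intro y hy hyw
    by_contra! hcon
    apply hy
    have : Disjoint y (Finset.univ.sup V) :=
      Finset.disjoint_sup_right.2 fun j _ => disjoint_iff.2 (hcon j)
    exact disjoint_self.1 (this.mono_right (hyw.trans hV))
  induction n with
  | zero =>
    obtain ⟨j, -⟩ := step w hw le_rfl
    exact ⟨w, hw, le_rfl, fun _ => j, by simp⟩
  | succ n ih =>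
    obtain ⟨x, hx0, hxw, j, hj⟩ := ih
    obtain ⟨i₀, hi₀⟩ := step (ρ (g ^ n) x) (by simpa using hx0)
      (((ρ (g ^ n)).monotone hxw).trans (hpow n).le)
    set z := ρ (g ^ n)⁻¹ (ρ (g ^ n) x ⊓ V i₀) with hz
    have hzx : z ≤ x := by
      have := (ρ (g ^ n)⁻¹).monotone (inf_le_left : ρ (g ^ n) x ⊓ V i₀ ≤ _)
      rwa [inv_apply_apply] at this
    refine ⟨z, ?_, hzx.trans hxw, Function.update j n i₀, ?_⟩
    · rw [hz, Ne, map_eq_bot_iff]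
      exact hi₀
    · intro i hi
      rcases Nat.lt_succ_iff_lt_or_eq.1 hi with hi | rfl
      · rw [Function.update_of_ne hi.ne]
        exact ((ρ (g ^ i)).monotone hzx).trans (hj i hi)
      · rw [Function.update_self, hz, apply_inv_apply]
        exact inf_le_right

/-- A pigeonhole argument. On an overlap there is a nonzero `V` disjoint from its translates by `g,
…, g ^ 4` and from `f V`. For `k` supported in `V`, the double commutator is nontrivial and commutes
with `g`, so its support is `g`-invariant; yet that support is covered by four translates of `V` by
elements commuting with `g`. Five successive `g`-translates of a small piece cannot fit in four such
sets. -/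
theorem disjoint_of_algDisjoint (h : IsSupportedAction ρ σ) {f g : G} (hfg : AlgDisjoint f g) :
    Disjoint (σ f) (σ (g ^ 12)) := by
  by_contra hd
  -- The exponent 12 is the least common multiple of 1, 2, 3, 4, so each of `g, …, g ^ 4` moves
  -- something inside every nonzero element below `σ (g ^ 12)`.
  have hpow : ∀ i, i ∣ 12 → σ (g ^ 12) ≤ σ (g ^ i) := by
    rintro i ⟨m, hm⟩
    rw [hm, pow_mul]
    exact h.supp_pow_le le_rfl m
  have shrink : ∀ (i : ℕ) (u : B), i ∣ 12 → u ≠ ⊥ → u ≤ σ (g ^ 12) →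
      ∃ v, v ≠ ⊥ ∧ v ≤ u ∧ Disjoint v (ρ (g ^ i) v) := by
    intro i u hi hu hle
    refine h.exists_moved fun hdis => hu (disjoint_self.1 (hdis.mono_right ?_))
    exact hle.trans (hpow i hi)
  obtain ⟨u, hu0, hule, hud⟩ := h.exists_moved (g := f) (e := σ f ⊓ σ (g ^ 12)) (by
    intro hdis
    apply hd
    rw [disjoint_iff]
    exact disjoint_self.1 (hdis.mono_right inf_le_left))
  have hu12 := hule.trans inf_le_right
  obtain ⟨v₁, hv₁, hl₁, hd₁⟩ := shrink 1 u (by norm_num) hu0 hu12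
  obtain ⟨v₂, hv₂, hl₂, hd₂⟩ := shrink 2 v₁ (by norm_num) hv₁ (hl₁.trans hu12)
  obtain ⟨v₃, hv₃, hl₃, hd₃⟩ := shrink 3 v₂ (by norm_num) hv₂ (hl₂.trans (hl₁.trans hu12))
  obtain ⟨V, hV, hl₄, hd₄⟩ := shrink 4 v₃ (by norm_num) hv₃
    (hl₃.trans (hl₂.trans (hl₁.trans hu12)))
  have hle₂ : V ≤ v₂ := hl₄.trans hl₃
  have hle₁ : V ≤ v₁ := hle₂.trans hl₂
  have hdis : ∀ i, 0 < i → i < 5 → Disjoint V (ρ (g ^ i) V) := by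
    intro i hi hi5
    interval_cases i
    · exact hd₁.mono hle₁ ((ρ _).monotone hle₁)
    · exact hd₂.mono hle₂ ((ρ _).monotone hle₂)
    · exact hd₃.mono hl₄ ((ρ _).monotone hl₄)
    · exact hd₄
  have hVf : Disjoint V (ρ f V) :=
    hud.mono (hle₁.trans hl₁) ((ρ f).monotone (hle₁.trans hl₁))
  obtain ⟨k, hk1, -, hkV⟩ := h.exists_involution V hV
  obtain ⟨f₁, f₂, hc₁, hc₂, hne, hc⟩ := hfg k (h.not_commute hVf hkV hk1)
  -- Expanded, the double commutator is a product of conjugates of `k` and `k⁻¹` by these four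
  -- elements.
  set t : Fin 4 → G := ![1, f₁, f₂, f₁ * f₂] with ht
  have htc : ∀ j, Commute (t j) g := by
    intro j
    fin_cases j
    · exact Commute.one_left g
    · exact hc₁
    · exact hc₂
    · exact hc₁.mul_left hc₂
  have hcov : σ ⁅f₁, ⁅f₂, k⁆⁆ ≤ Finset.univ.sup fun j => ρ (t j) V := by
    refine (h.supp_commutator_le (h.supp_commutator_le hkV)).trans ?_
    have hj : ∀ j, ρ (t j) V ≤ Finset.univ.sup fun j => ρ (t j) V := fun j =>
      Finset.le_sup (f := fun j => ρ (t j) V) (Finset.mem_univ j)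
    rw [map_sup, ← mul_apply]
    refine sup_le (sup_le (hj 3) (hj 1)) (sup_le (hj 2) ?_)
    have := hj 0
    simpa [ht] using this
  obtain ⟨x, hx0, -, j, hj⟩ := exists_itinerary ρ (h.supp_ne_bot hne)
    (h.apply_supp_of_commute hc.symm) (fun j => ρ (t j) V) hcov 5
  obtain ⟨a, b, hab, hjab⟩ := Fintype.exists_ne_map_eq_of_card_lt
    (fun i : Fin 5 => j i) (by simp)
  have final : ∀ a b : ℕ, a < b → b < 5 → j a = j b → False := by
    intro a b hab hb hjab
    have ha := hj a (hab.trans hb)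
    have hb' := hj b hb
    rw [← hjab] at hb'
    -- Applying `g ^ (b - a)` to the bound at time `a`, and commuting it past `t (j a)`, puts the
    -- same translate below a set disjoint from `t (j a) V`.
    have hx2 : ρ (g ^ b) x ≤ ρ (t (j a)) (ρ (g ^ (b - a)) V) := by
      rw [← mul_apply, ((htc (j a)).pow_right _).eq, mul_apply]
      have : g ^ b = g ^ (b - a) * g ^ a := by rw [← pow_add, Nat.sub_add_cancel hab.le]
      rw [this, mul_apply]
      exact (ρ _).monotone ha
    have := ((disjoint_apply ρ (t (j a))).2 (hdis (b - a) (by omega) (by omega))).mono hb' hx2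
    rw [disjoint_self, map_eq_bot_iff] at this
    exact hx0 this
  rcases lt_or_gt_of_ne (fun hh => hab (Fin.ext hh) : (a : ℕ) ≠ b) with hlt | hlt
  · exact final a b hlt b.2 hjab
  · exact final b a hlt a.2 hjab.symm

/-- An odometer construction. If the involution `g` moves `v` off itself and `k` is supported in
`v`, then `(g k) ^ 2` acts on `v` as `k`, while odd powers of `g k` send `v` to `g v`. Each step
doubles the number of disjoint translates. -/
theorem exists_pow_moves (h : IsSupportedAction ρ σ) (m : ℕ) : ∀ e : B, e ≠ ⊥ →
    ∃ k : G, σ k ≤ e ∧ ∃ u, u ≠ ⊥ ∧ u ≤ e ∧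
      ∀ i, 0 < i → i < 2 ^ m → Disjoint u (ρ (k ^ i) u) := by
  induction m with
  | zero =>
    intro e he
    exact ⟨1, h.supp_one.le.trans bot_le, e, he, le_rfl, fun i h1 h2 => by simp at h2; omega⟩
  | succ m ih =>
    intro e he
    obtain ⟨g, hg1, hgg, hge⟩ := h.exists_involution e he
    obtain ⟨v, hv0, hvg, hvd⟩ := h.exists_moved (g := g) (e := σ g)
      (by rw [disjoint_self]; exact h.supp_ne_bot hg1)
    have hve := hvg.trans hge
    obtain ⟨k, hkv, u, hu0, huv, hu⟩ := ih v hv0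
    have hkfix : ρ k v = v := by
      have h1 : ρ k vᶜ = vᶜ := h.fix (disjoint_compl_left.mono_right hkv)
      rw [map_compl] at h1
      exact compl_injective h1
    have hkle : ∀ x ≤ v, ρ k x ≤ v := fun x hx => ((ρ k).monotone hx).trans hkfix.le
    have hsq : ∀ x ≤ v, ρ (g * k) (ρ (g * k) x) = ρ k x := by
      intro x hx
      rw [mul_apply, mul_apply, h.fix (g := k) (x := ρ g (ρ k x)), ← mul_apply, hgg]
      · simp
      · exact (hvd.symm.mono_left ((ρ g).monotone (hkle x hx))).mono_right hkv
    have hpk : ∀ i, ∀ x ≤ v, ρ (k ^ i) x ≤ v := by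
      intro i
      induction i with
      | zero => simp
      | succ i ih' =>
        intro x hx
        rw [pow_succ, mul_apply]
        exact ih' _ (hkle x hx)
    have heven : ∀ i, ∀ x ≤ v, ρ ((g * k) ^ (2 * i)) x = ρ (k ^ i) x := by
      intro i
      induction i with
      | zero => simp
      | succ i ih' =>
        intro x hx
        have : (g * k) ^ (2 * (i + 1)) = (g * k) ^ (2 * i) * ((g * k) * (g * k)) := by
          rw [mul_add, pow_add, mul_one, pow_two]
        rw [this, mul_apply, mul_apply, hsq x hx, ih' _ (hkle x hx), pow_succ, mul_apply]
    refine ⟨g * k, h.supp_mul_le hge (hkv.trans hve), u, hu0, huv.trans hve, ?_⟩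
    intro i hi hlt
    rcases Nat.even_or_odd' i with ⟨l, rfl | rfl⟩
    · rw [heven l u huv]
      exact hu l (by omega) (by rw [pow_succ] at hlt; omega)
    · rw [pow_succ', mul_apply, heven l u huv, mul_apply]
      exact hvd.mono huv ((ρ g).monotone (hkle _ (hpk l u huv)))

theorem exists_pow_ne_one (h : IsSupportedAction ρ σ) {e : B} (he : e ≠ ⊥) :
    ∃ g : G, σ g ≤ e ∧ g ^ 12 ≠ 1 := by
  -- Four doublings give exponents up to 15, past the required 12.
  obtain ⟨k, hk, u, hu0, -, hu⟩ := h.exists_pow_moves 4 e he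
  refine ⟨k, hk, fun h1 => hu0 ?_⟩
  have := hu 12 (by norm_num) (by norm_num)
  rw [h1] at this
  simpa using this

/-! ### Reconstructing the Boolean algebra from the group -/

/-- Inclusion of supports is a group-theoretic relation. -/
theorem supp_le_supp_iff (h : IsSupportedAction ρ σ) (k f : G) :
    σ k ≤ σ f ↔ ∀ g, AlgDisjoint f g → Commute k (g ^ 12) := by
  constructor
  · intro hle g hg
    exact h.commute_of_disjoint ((h.disjoint_of_algDisjoint hg).mono_left hle)
  · intro H
    by_contra hle
    obtain ⟨u, hu0, hue, hud⟩ := h.exists_moved (g := k) (e := σ k \ σ f) (by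
      intro hd
      apply hle
      rw [← sdiff_eq_bot_iff]
      exact disjoint_self.1 (hd.mono_right sdiff_le))
    -- Such a `g` has support disjoint from that of `f`, yet its twelfth power lives where `k` moves
    -- everything off.
    obtain ⟨g, hgu, hg12⟩ := h.exists_pow_ne_one hu0
    refine h.not_commute hud (h.supp_pow_le hgu 12) hg12 (H g ?_)
    exact h.algDisjoint_of_disjoint (disjoint_sdiff_self_right.mono_right (hgu.trans hue))

/-- Every nonzero element bounds a nonzero support, so overlaps are detected by supports. The bottom
is written `σ 1` so that the criterion uses only the relation that group isomorphisms transport. -/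
theorem disjoint_supp_iff (h : IsSupportedAction ρ σ) (f g : G) :
    Disjoint (σ f) (σ g) ↔ ∀ k, σ k ≤ σ f → σ k ≤ σ g → σ k ≤ σ 1 := by
  constructor
  · intro hd k h1 h2
    rw [disjoint_self.1 (hd.mono h1 h2)]
    exact bot_le
  · intro H
    rw [disjoint_iff]
    by_contra hne
    obtain ⟨k, hk1, -, hk⟩ := h.exists_involution _ hne
    have := H k (hk.trans inf_le_left) (hk.trans inf_le_right)
    rw [h.supp_one, le_bot_iff] at this
    exact h.supp_ne_bot hk1 this

/-- Again a nonzero remainder would contain a nonzero support; finite coverings thus reduce to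
inclusion and disjointness of supports. -/
theorem supp_le_sup_iff (h : IsSupportedAction ρ σ) (f : G) (s : Finset G) :
    σ f ≤ s.sup σ ↔ ∀ k, σ k ≤ σ f → (∀ g ∈ s, Disjoint (σ k) (σ g)) → σ k ≤ σ 1 := by
  constructor
  · intro hle k hk hd
    rw [disjoint_self.1 ((Finset.disjoint_sup_right.2 hd).mono_right (hk.trans hle))]
    exact bot_le
  · intro H
    by_contra hle
    rw [← sdiff_eq_bot_iff] at hle
    obtain ⟨k, hk1, -, hk⟩ := h.exists_involution _ hle
    have := H k (hk.trans sdiff_le) fun g hg =>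
      (disjoint_sdiff_self_left.mono_left hk).mono_right (Finset.le_sup hg)
    rw [h.supp_one, le_bot_iff] at this
    exact h.supp_ne_bot hk1 this

/-- Two supported actions of isomorphic groups are conjugate. -/
theorem exists_orderIso {C H : Type*} [BooleanAlgebra C] [Group H] {ρ' : H →* (C ≃o C)}
    {σ' : H → C} (h : IsSupportedAction ρ σ) (h' : IsSupportedAction ρ' σ') (α : G ≃* H) :
    ∃ θ : B ≃o C, ∀ g x, θ (ρ g x) = ρ' (α g) (θ x) := by
  have hle : ∀ f g, σ f ≤ σ g ↔ σ' (α f) ≤ σ' (α g) := by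
    intro f g
    rw [h.supp_le_supp_iff, h'.supp_le_supp_iff, α.surjective.forall]
    simp only [algDisjoint_map_equiv, ← map_pow, commute_map_equiv]
  have hdis : ∀ f g, Disjoint (σ f) (σ g) ↔ Disjoint (σ' (α f)) (σ' (α g)) := by
    intro f g
    rw [h.disjoint_supp_iff, h'.disjoint_supp_iff, α.surjective.forall]
    simp only [hle, map_one]
  have hsup : ∀ s t : Finset G, s.sup σ ≤ t.sup σ ↔
      s.sup (fun g => σ' (α g)) ≤ t.sup (fun g => σ' (α g)) := by
    have himg : ∀ t : Finset G, t.sup (fun g => σ' (α g)) =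
        (t.map α.toEquiv.toEmbedding).sup σ' := by
      intro t; rw [Finset.sup_map]; rfl
    intro s t
    rw [Finset.sup_le_iff, Finset.sup_le_iff]
    refine forall₂_congr fun f _ => ?_
    rw [himg, h.supp_le_sup_iff, h'.supp_le_sup_iff, α.surjective.forall]
    simp only [hle, hdis, map_one, Finset.mem_map, forall_exists_index, and_imp,
      forall_apply_eq_imp_iff₂]
    rfl
  choose c hc using h.exists_sup
  -- By `hsup`, the value does not depend on the chosen decomposition of `e` into supports.
  set θ₀ : B → C := fun e => (c e).sup (fun g => σ' (α g)) with hθ₀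
  have hθle : ∀ x y, θ₀ x ≤ θ₀ y ↔ x ≤ y := by
    intro x y
    rw [hθ₀, ← hsup, hc, hc]
  have hθsup : ∀ s : Finset G, θ₀ (s.sup σ) = s.sup (fun g => σ' (α g)) := by
    intro s
    apply le_antisymm
    · rw [hθ₀, ← hsup, hc]
    · rw [hθ₀, ← hsup, hc]
  have hsurj : Function.Surjective θ₀ := by
    intro y
    obtain ⟨s, rfl⟩ := h'.exists_sup y
    refine ⟨(s.map α.symm.toEquiv.toEmbedding).sup σ, ?_⟩
    rw [hθsup, Finset.sup_map]
    congr 1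
    funext g
    simp
  refine ⟨RelIso.ofSurjective (OrderEmbedding.ofMapLEIff θ₀ hθle) hsurj, fun g x => ?_⟩
  change θ₀ (ρ g x) = ρ' (α g) (θ₀ x)
  obtain ⟨s, rfl⟩ := h.exists_sup x
  have hs : ρ g (s.sup σ) = (s.map (MulAut.conj g).toEquiv.toEmbedding).sup σ := by
    rw [Finset.sup_map, map_finset_sup]
    congr 1
    funext k
    exact (h.supp_conj g k).symm
  rw [hs, hθsup, hθsup, Finset.sup_map, map_finset_sup]
  congr 1
  funext k
  simp [← h'.supp_conj]

end IsSupportedAction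

/-! ### Calculus in inverse monoids -/

namespace InverseMonoidWithZero

variable {S : Type u} [InverseMonoidWithZero S]

theorem inv_inv_eq (s : S) : s⁻¹⁻¹ = s :=
  (inv_unique s⁻¹ s (inv_mul_inv s) (mul_inv_mul s)).symm

theorem inv_mul_rev (a b : S) : (a * b)⁻¹ = b⁻¹ * a⁻¹ := by
  have hc := idem_comm (mul_inv_self_idem b) (inv_mul_self_idem a)
  refine (inv_unique (a * b) (b⁻¹ * a⁻¹) ?_ ?_).symm
  · calc a * b * (b⁻¹ * a⁻¹) * (a * b) = a * ((b * b⁻¹) * (a⁻¹ * a)) * b := by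
          simp only [mul_assoc]
      _ = (a * a⁻¹ * a) * (b * b⁻¹ * b) := by rw [hc]; simp only [mul_assoc]
      _ = a * b := by rw [mul_inv_mul, mul_inv_mul]
  · calc b⁻¹ * a⁻¹ * (a * b) * (b⁻¹ * a⁻¹) = b⁻¹ * ((a⁻¹ * a) * (b * b⁻¹)) * a⁻¹ := by
          simp only [mul_assoc]
      _ = (b⁻¹ * b * b⁻¹) * (a⁻¹ * a * a⁻¹) := by rw [← hc]; simp only [mul_assoc]
      _ = b⁻¹ * a⁻¹ := by rw [inv_mul_inv, inv_mul_inv]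

theorem zero_inv_eq : (0 : S)⁻¹ = 0 := inv_of_idem (mul_zero 0)

theorem val_inv (g : Sˣ) : ((g⁻¹ : Sˣ) : S) = (g : S)⁻¹ :=
  inv_unique _ _ (by simp) (by simp)

theorem le_iff_eq_mul_dom {a b : S} : a ≤ b ↔ a = b * (a⁻¹ * a) := by
  rw [le_def, mul_assoc]

theorem mul_idem_le (b : S) {e : S} (he : e * e = e) : b * e ≤ b := by
  rw [le_def, inv_mul_rev, inv_of_idem he]
  calc b * e = b * b⁻¹ * b * (e * e) := by rw [mul_inv_mul, he]
    _ = b * ((b⁻¹ * b) * e) * e := by simp only [mul_assoc]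
    _ = b * (e * (b⁻¹ * b)) * e := by rw [idem_comm (inv_mul_self_idem b) he]
    _ = b * (e * b⁻¹) * (b * e) := by simp only [mul_assoc]

theorem mul_idem_mul_inv_idem (b : S) {e : S} (he : e * e = e) :
    (b * e * b⁻¹) * (b * e * b⁻¹) = b * e * b⁻¹ := by
  calc (b * e * b⁻¹) * (b * e * b⁻¹) = b * (e * (b⁻¹ * b)) * (e * b⁻¹) := by
        simp only [mul_assoc]
    _ = (b * b⁻¹ * b) * (e * e) * b⁻¹ := by
        rw [idem_comm he (inv_mul_self_idem b)]; simp only [mul_assoc]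
    _ = b * e * b⁻¹ := by rw [mul_inv_mul, he]

theorem mul_idem_eq (b : S) {e : S} (he : e * e = e) : b * e = b * e * b⁻¹ * b := by
  rw [mul_assoc, mul_assoc, idem_comm he (inv_mul_self_idem b), ← mul_assoc, ← mul_assoc,
    mul_inv_mul]

theorem idem_mul_eq (b : S) {e : S} (he : e * e = e) : e * b = b * (b⁻¹ * e * b) := by
  calc e * b = e * (b * b⁻¹) * b := by rw [mul_assoc, mul_inv_mul]
    _ = b * (b⁻¹ * e * b) := by
      rw [idem_comm he (mul_inv_self_idem b)]; simp only [mul_assoc]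

theorem inv_mul_idem_mul_idem (b : S) {e : S} (he : e * e = e) :
    (b⁻¹ * e * b) * (b⁻¹ * e * b) = b⁻¹ * e * b := by
  have := mul_idem_mul_inv_idem b⁻¹ he
  rwa [inv_inv_eq] at this

theorem idem_mul_le (b : S) {e : S} (he : e * e = e) : e * b ≤ b := by
  rw [idem_mul_eq b he]
  exact mul_idem_le b (inv_mul_idem_mul_idem b he)

theorem mul_le_mul_left_of_le (c : S) {a b : S} (h : a ≤ b) : c * a ≤ c * b := by
  rw [le_iff_eq_mul_dom] at h
  rw [h, ← mul_assoc]
  exact mul_idem_le _ (inv_mul_self_idem a)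

theorem isIdempotentElem_of_le {a e : S} (he : IsIdempotentElem e) (h : a ≤ e) :
    IsIdempotentElem a := by
  rw [le_iff_eq_mul_dom] at h
  rw [h]
  exact idem_mul_idem he (inv_mul_self_idem a)

theorem le_one_of_idem {e : S} (he : IsIdempotentElem e) : e ≤ 1 := by
  simpa using mul_idem_le (1 : S) he.eq

theorem zero_le_elem (a : S) : 0 ≤ a := by
  simpa using mul_idem_le a (mul_zero 0)

theorem eq_of_isLUB_pair_zero_right {a j : S} (h : IsLUB {a, 0} j) : j = a :=
  le_antisymm (h.2 (by simp [upperBounds, zero_le_elem])) (h.1 (by simp))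

theorem eq_of_isLUB_pair_zero_left {a j : S} (h : IsLUB {0, a} j) : j = a :=
  le_antisymm (h.2 (by simp [upperBounds, zero_le_elem])) (h.1 (by simp))

theorem compatible_of_idem {e f : S} (he : e * e = e) (hf : f * f = f) : Compatible e f := by
  rw [Compatible, inv_of_idem he, inv_of_idem hf]
  exact ⟨idem_mul_idem he hf, idem_mul_idem he hf⟩

theorem le_iff_mul_eq {e : S} (he : e * e = e) {b : S} : e ≤ b ↔ b * e = e := by
  rw [le_iff_eq_mul_dom, inv_of_idem he, he, eq_comm]

/-- Elements acting in the same way on the idempotents are equal in a fundamental inverse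
monoid. -/
theorem eq_of_forall_conj_eq (hS : IsFundamental S) {s t : S}
    (h : ∀ e : S, e * e = e → s * e * s⁻¹ = t * e * t⁻¹) : s = t := by
  have hr : s * s⁻¹ = t * t⁻¹ := by simpa using h 1 (mul_one 1)
  have key : ∀ (s t : S), (∀ e : S, e * e = e → s * e * s⁻¹ = t * e * t⁻¹) → ∀ f : S,
      f * f = f → t⁻¹ * f * t = (t⁻¹ * t) * (s⁻¹ * f * s) := by
    intro s t h f hf
    have hr : s * s⁻¹ = t * t⁻¹ := by simpa using h 1 (mul_one 1)
    have h1 := h _ (inv_mul_idem_mul_idem s hf)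
    have h2 : s * (s⁻¹ * f * s) * s⁻¹ = f * (t * t⁻¹) := by
      rw [← idem_mul_eq s hf, mul_assoc, hr]
    rw [h2] at h1
    have hi := inv_mul_idem_mul_idem s hf
    calc t⁻¹ * f * t = t⁻¹ * (f * (t * t⁻¹)) * t := by
          simp only [mul_assoc]; rw [← mul_assoc t t⁻¹ t, mul_inv_mul]
      _ = (t⁻¹ * t) * ((s⁻¹ * f * s) * (t⁻¹ * t)) := by rw [h1]; simp only [mul_assoc]
      _ = (t⁻¹ * t) * (s⁻¹ * f * s) := by
          rw [idem_comm hi (inv_mul_self_idem t), ← mul_assoc, inv_mul_self_idem]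
  have hd : s⁻¹ * s = t⁻¹ * t := by
    have h1 := key s t h 1 (mul_one 1)
    have h2 := key t s (fun e he => (h e he).symm) 1 (mul_one 1)
    simp only [mul_one] at h1 h2
    rw [h1, idem_comm (inv_mul_self_idem t) (inv_mul_self_idem s), ← h2]
  -- Equal actions make `s⁻¹ t` commute with all idempotents; fundamentality then gives `t ≤ s`, and
  -- equal domains give equality.
  have ha : IsIdempotentElem (s⁻¹ * t) := by
    refine hS _ fun e he => ?_
    have he' : e * e = e := he
    calc s⁻¹ * t * e = s⁻¹ * (t * e * t⁻¹ * t) := by rw [← mul_idem_eq t he', mul_assoc]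
      _ = s⁻¹ * (t * e * t⁻¹) * t := by rw [mul_assoc s⁻¹]
      _ = ((s⁻¹ * s) * e) * s⁻¹ * t := by rw [← h e he']; simp only [mul_assoc]
      _ = e * (s⁻¹ * s * s⁻¹) * t := by
          rw [idem_comm (inv_mul_self_idem s) he']; simp only [mul_assoc]
      _ = e * (s⁻¹ * t) := by rw [inv_mul_inv, mul_assoc]
  have hts : t = s * (s⁻¹ * t) := by rw [← mul_assoc, hr, mul_inv_mul]
  have hle : t ≤ s := by
    rw [hts]; exact mul_idem_le s ha.eq
  rw [le_iff_eq_mul_dom, ← hd, ← mul_assoc, mul_inv_mul] at hle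
  exact hle.symm

end InverseMonoidWithZero

/-! ### The Boolean algebra of idempotents -/

namespace Idem

variable {S : Type u} [InverseMonoidWithZero S]

theorem mul_self (e : Idem S) : e.1 * e.1 = e.1 := e.2.eq

theorem le_iff' {e f : Idem S} : e ≤ f ↔ f.1 * e.1 = e.1 := by rw [le_iff, eq_comm]

theorem coe_le_coe {e f : Idem S} : e.1 ≤ f.1 ↔ e ≤ f := Iff.rfl

/-- The Boolean algebra structure provided by `IsBooleanInverse`. -/
@[reducible]
noncomputable def booleanData (S : Type u) [InverseMonoidWithZero S] [IsBooleanInverse S] :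
    BooleanAlgebra (Idem S) :=
  (IsBooleanInverse.boolean (S := S)).choose

theorem booleanData_le [IsBooleanInverse S] {e f : Idem S} :
    (booleanData S).le e f ↔ e ≤ f :=
  (IsBooleanInverse.boolean (S := S)).choose_spec e f

/-- The Boolean algebra structure on the idempotents, for the natural partial order. -/
noncomputable instance instBooleanAlgebra [IsBooleanInverse S] : BooleanAlgebra (Idem S) :=
  -- The order and bounds are the existing ones, so that `≤`, `⊥` and `⊤` still unfold to the
  -- natural order, `0` and `1`.
  { (inferInstance : PartialOrder (Idem S)), (inferInstance : BoundedOrder (Idem S)) with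
    sup := (booleanData S).sup
    inf := (booleanData S).inf
    compl := (booleanData S).compl
    sdiff := fun a b => (booleanData S).inf a ((booleanData S).compl b)
    himp := fun a b => (booleanData S).sup b ((booleanData S).compl a)
    sdiff_eq := fun _ _ => rfl
    himp_eq := fun _ _ => rfl
    le_sup_left := fun a b => booleanData_le.1 ((booleanData S).le_sup_left a b)
    le_sup_right := fun a b => booleanData_le.1 ((booleanData S).le_sup_right a b)
    sup_le := fun a b c h1 h2 => booleanData_le.1
      ((booleanData S).sup_le a b c (booleanData_le.2 h1) (booleanData_le.2 h2))
    inf_le_left := fun a b => booleanData_le.1 ((booleanData S).inf_le_left a b)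
    inf_le_right := fun a b => booleanData_le.1 ((booleanData S).inf_le_right a b)
    le_inf := fun a b c h1 h2 => booleanData_le.1
      ((booleanData S).le_inf a b c (booleanData_le.2 h1) (booleanData_le.2 h2))
    le_sup_inf := fun a b c => booleanData_le.1 ((booleanData S).le_sup_inf a b c)
    inf_compl_le_bot := fun a =>
      (booleanData_le.1 ((booleanData S).inf_compl_le_bot a)).trans
        (booleanData_le.1 ((booleanData S).bot_le ⟨0, mul_zero 0⟩))
    top_le_sup_compl := fun a =>
      (booleanData_le.1 ((booleanData S).le_top ⟨1, one_mul 1⟩)).trans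
        (booleanData_le.1 ((booleanData S).top_le_sup_compl a)) }

variable [IsBooleanInverse S]

theorem coe_inf (e f : Idem S) : (e ⊓ f).1 = e.1 * f.1 := by
  have : e ⊓ f = (⟨e.1 * f.1, idem_mul_idem e.mul_self f.mul_self⟩ : Idem S) := by
    apply le_antisymm
    · have h1 := le_iff'.1 (inf_le_left : e ⊓ f ≤ e)
      have h2 := le_iff'.1 (inf_le_right : e ⊓ f ≤ f)
      refine le_iff'.2 ?_
      rw [mul_assoc, h2, h1]
    · refine le_inf ?_ ?_
      · refine le_iff'.2 ?_
        rw [← mul_assoc, e.mul_self]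
      · refine le_iff'.2 ?_
        change f.1 * (e.1 * f.1) = e.1 * f.1
        rw [idem_comm e.mul_self f.mul_self, ← mul_assoc, f.mul_self]
  rw [this]

theorem coe_bot : (⊥ : Idem S).1 = 0 := rfl

theorem coe_top : (⊤ : Idem S).1 = 1 := rfl

theorem disjoint_iff_mul {e f : Idem S} : Disjoint e f ↔ e.1 * f.1 = 0 := by
  rw [disjoint_iff, ← coe_inf]
  exact ⟨fun h => congrArg Subtype.val h, fun h => Subtype.ext h⟩

/-- A join of idempotents taken in `S` lies below `1`, hence is idempotent. This lets the
distributivity axioms act on joins of idempotents. -/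
theorem isLUB_sup (e f : Idem S) : IsLUB {e.1, f.1} (e ⊔ f).1 := by
  obtain ⟨j, hj⟩ := IsBooleanInverse.exists_join e.1 f.1
    (compatible_of_idem e.mul_self f.mul_self)
  have hidem : IsIdempotentElem j :=
    isIdempotentElem_of_le (mul_one 1)
      (hj.2 (by simp [upperBounds, le_one_of_idem e.2, le_one_of_idem f.2]))
  have : e ⊔ f = (⟨j, hidem⟩ : Idem S) := by
    apply le_antisymm
    · exact sup_le (hj.1 (by simp)) (hj.1 (by simp))
    · refine coe_le_coe.1 (hj.2 ?_)
      simp only [upperBounds_insert, upperBounds_singleton, Set.mem_inter_iff, Set.mem_Ici]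
      exact ⟨coe_le_coe.2 le_sup_left, coe_le_coe.2 le_sup_right⟩
  rw [this]
  exact hj

end Idem

/-! ### Covering by ranges and absence of atoms -/

namespace Idem

variable {S : Type u} [InverseMonoidWithZero S]

/-- The partial action `e ↦ t e t⁻¹` of an arbitrary element on the idempotents. -/
def partialConj (t : S) (e : Idem S) : Idem S :=
  ⟨t * e.1 * t⁻¹, mul_idem_mul_inv_idem t e.mul_self⟩

theorem ran_mul (t c : S) : ran (t * c) = partialConj t (ran c) := by
  apply Subtype.ext
  change t * c * (t * c)⁻¹ = t * (c * c⁻¹) * t⁻¹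
  rw [inv_mul_rev]
  simp only [mul_assoc]

theorem ran_le_iff {x : S} {e : Idem S} : ran x ≤ e ↔ e.1 * x = x := by
  rw [le_iff']
  change e.1 * (x * x⁻¹) = x * x⁻¹ ↔ _
  constructor
  · intro h
    rw [← mul_inv_mul x, ← mul_assoc, h]
  · intro h
    rw [← mul_assoc, h]

theorem dom_le_iff {x : S} {e : Idem S} : dom x ≤ e ↔ x * e.1 = x := by
  rw [le_iff']
  change e.1 * (x⁻¹ * x) = x⁻¹ * x ↔ _
  rw [← idem_comm (inv_mul_self_idem x) e.mul_self]
  constructor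
  · intro h
    rw [← mul_inv_mul x, mul_assoc x, mul_assoc x, h]
  · intro h
    rw [mul_assoc, h]

theorem dom_mul_le (t c : S) : dom (t * c) ≤ dom c := by
  rw [dom_le_iff]
  change t * c * (c⁻¹ * c) = _
  rw [mul_assoc, ← mul_assoc c, mul_inv_mul]

theorem ran_mul_le (x t : S) : ran (x * t) ≤ ran x := by
  rw [ran_le_iff]
  change x * x⁻¹ * (x * t) = _
  rw [← mul_assoc, mul_inv_mul]

theorem ran_zero : ran (0 : S) = ⊥ := Subtype.ext (zero_mul _)

theorem ran_coe (e : Idem S) : ran e.1 = e := by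
  apply Subtype.ext
  change e.1 * e.1⁻¹ = _
  rw [inv_of_idem e.mul_self, e.mul_self]

theorem dom_coe (e : Idem S) : dom e.1 = e := by
  apply Subtype.ext
  change e.1⁻¹ * e.1 = _
  rw [inv_of_idem e.mul_self, e.mul_self]

theorem partialConj_bot (t : S) : partialConj t ⊥ = ⊥ := by
  apply Subtype.ext
  change t * 0 * t⁻¹ = 0
  simp

variable [IsBooleanInverse S]

theorem partialConj_sup (t : S) (e f : Idem S) :
    partialConj t (e ⊔ f) = partialConj t e ⊔ partialConj t f := by
  have h1 := IsBooleanInverse.mul_join e.1 f.1 _ t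
    (compatible_of_idem e.mul_self f.mul_self) (isLUB_sup e f)
  -- Distributing on the right by `t⁻¹` requires the left multiples to be compatible as well.
  have hc : Compatible (t * e.1) (t * f.1) := by
    have hef : e.1 * f.1 = (e ⊓ f).1 := (coe_inf e f).symm
    constructor
    · have : (t * e.1)⁻¹ * (t * f.1) = (e ⊓ dom t ⊓ f).1 := by
        rw [coe_inf, coe_inf, inv_mul_rev, inv_of_idem e.mul_self]
        simp only [dom, mul_assoc]
      rw [this]
      exact (e ⊓ dom t ⊓ f).2
    · have : t * e.1 * (t * f.1)⁻¹ = (partialConj t (e ⊓ f)).1 := by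
        rw [inv_mul_rev, inv_of_idem f.mul_self]
        change _ = t * (e ⊓ f).1 * t⁻¹
        rw [coe_inf]
        simp only [mul_assoc]
      rw [this]
      exact (partialConj t (e ⊓ f)).2
  have h2 := IsBooleanInverse.join_mul _ _ _ t⁻¹ hc h1
  exact Subtype.ext (h2.unique (isLUB_sup (partialConj t e) (partialConj t f)))

theorem partialConj_finset_sup {ι : Type*} (t : S) (s : Finset ι) (f : ι → Idem S) :
    partialConj t (s.sup f) = s.sup fun i => partialConj t (f i) :=
  Finset.apply_sup_eq_sup_comp (partialConj t) (partialConj_sup t) (partialConj_bot t)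

/-- In a `0`-simplifying monoid finitely many elements with domain below a given nonzero
idempotent have ranges covering the identity. -/
theorem exists_ran_sup_eq_top (hS : IsZeroSimplifying S) {e : Idem S} (he : e ≠ ⊥) :
    ∃ s : Finset S, (∀ c ∈ s, dom c ≤ e) ∧ s.sup ran = ⊤ := by
  classical
  -- This is a `∨`-closed ideal containing `e`, hence all of `S`; the claim is that it contains `1`.
  set I : Set S := {x | ∃ s : Finset S, (∀ c ∈ s, dom c ≤ e) ∧ ran x ≤ s.sup ran} with hI
  have hideal : IsSemigroupIdeal I := by
    refine ⟨⟨0, ∅, by simp, ran_zero.le.trans bot_le⟩, ?_⟩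
    rintro x ⟨s, hs, hx⟩ t
    refine ⟨⟨s.image (t * ·), ?_, ?_⟩, ⟨s, hs, (ran_mul_le x t).trans hx⟩⟩
    · intro c hc
      obtain ⟨d, hd, rfl⟩ := Finset.mem_image.1 hc
      exact (dom_mul_le t d).trans (hs d hd)
    · have : (s.image (t * ·)).sup ran = partialConj t (s.sup ran) := by
        rw [Finset.sup_image, partialConj_finset_sup]
        congr 1
        funext c
        exact ran_mul t c
      rw [this, ran_mul, ← sup_eq_right.2 hx, partialConj_sup]
      exact le_sup_left
  have hvee : I = veeClosure I := by
    apply Set.Subset.antisymm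
    · intro x hx
      exact ⟨{x}, Set.finite_singleton x, Set.singleton_subset_iff.2 hx,
        Set.pairwise_singleton _ _, isLUB_singleton⟩
    · rintro j ⟨Y, hfin, hY, -, hj⟩
      choose! s hs hle using hY
      refine ⟨hfin.toFinset.biUnion s, ?_, ?_⟩
      · intro c hc
        obtain ⟨y, hy, hcy⟩ := Finset.mem_biUnion.1 hc
        exact hs (hfin.mem_toFinset.1 hy) c hcy
      · set k := (hfin.toFinset.biUnion s).sup ran with hk
        -- Left multiplication by `k` fixes every `y ∈ Y`, so `k j` is still an upper bound of `Y`.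
        have hkj : j ≤ k.1 * j := by
          refine hj.2 fun y hy => ?_
          have hyk : ran y ≤ k :=
            (hle hy).trans (Finset.sup_mono
              (Finset.subset_biUnion_of_mem s (hfin.mem_toFinset.2 hy)))
          rw [← ran_le_iff.1 hyk]
          exact mul_le_mul_left_of_le k.1 (hj.1 hy)
        exact ran_le_iff.2 (le_antisymm (idem_mul_le j k.mul_self) hkj)
  have heI : e.1 ∈ I := ⟨{e.1}, by simp [dom_coe], by simp⟩
  rcases hS I hideal hvee with h | h
  · rw [h] at heI
    exact absurd (Subtype.ext heI : e = ⊥) he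
  · have h1 : (1 : S) ∈ I := h ▸ Set.mem_univ _
    obtain ⟨s, hs, hle⟩ := h1
    have htop : ran (1 : S) = ⊤ := ran_coe ⊤
    rw [htop, top_le_iff] at hle
    exact ⟨s, hs, hle⟩

/-- Multiply a cover of the identity on the left by `f`. -/
theorem exists_ran_sup_eq (hS : IsZeroSimplifying S) {e : Idem S} (he : e ≠ ⊥) (f : Idem S) :
    ∃ s : Finset S, (∀ c ∈ s, dom c ≤ e ∧ ran c ≤ f) ∧ s.sup ran = f := by
  classical
  obtain ⟨s, hs, hsup⟩ := exists_ran_sup_eq_top hS he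
  refine ⟨s.image (f.1 * ·), ?_, ?_⟩
  · intro c hc
    obtain ⟨d, hd, rfl⟩ := Finset.mem_image.1 hc
    refine ⟨(dom_mul_le _ d).trans (hs d hd), ?_⟩
    rw [ran_le_iff, ← mul_assoc, f.mul_self]
  · have : (s.image (f.1 * ·)).sup ran = partialConj f.1 (s.sup ran) := by
      rw [Finset.sup_image, partialConj_finset_sup]
      congr 1
      funext c
      exact ran_mul f.1 c
    rw [this, hsup]
    apply Subtype.ext
    change f.1 * 1 * f.1⁻¹ = f.1
    rw [mul_one, inv_of_idem f.mul_self, f.mul_self]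

/-- The range of an element whose domain lies below an atom is zero or an atom. -/
theorem eq_bot_or_eq_ran {e : Idem S} (he : IsAtom e) {c : S} (hc : dom c ≤ e) {x : Idem S}
    (hx : x ≤ ran c) : x = ⊥ ∨ x = ran c := by
  have hxc : x.1 = c * (c⁻¹ * x.1 * c) * c⁻¹ := by
    have h1 : (ran c).1 * x.1 = x.1 := le_iff'.1 hx
    have h2 : x.1 * (ran c).1 = x.1 := by rw [idem_comm x.mul_self (ran c).mul_self, h1]
    calc x.1 = (c * c⁻¹) * x.1 * (c * c⁻¹) := by
          change (c * c⁻¹) * x.1 = x.1 at h1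
          change x.1 * (c * c⁻¹) = x.1 at h2
          rw [h1, h2]
      _ = _ := by simp only [mul_assoc]
  set y : Idem S := ⟨c⁻¹ * x.1 * c, inv_mul_idem_mul_idem c x.mul_self⟩ with hy
  have hyd : y ≤ dom c := by
    refine le_iff'.2 ?_
    change (c⁻¹ * c) * (c⁻¹ * x.1 * c) = c⁻¹ * x.1 * c
    rw [← mul_assoc, ← mul_assoc, inv_mul_inv]
  rcases he.le_iff.1 (hyd.trans hc) with h | h
  · left
    have h0 : c⁻¹ * x.1 * c = 0 := congrArg Subtype.val h
    apply Subtype.ext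
    rw [hxc, h0]
    simp [coe_bot]
  · right
    have hd : y = dom c := le_antisymm hyd (by rw [h]; exact hc)
    have h0 : c⁻¹ * x.1 * c = c⁻¹ * c := congrArg Subtype.val hd
    apply Subtype.ext
    rw [hxc, h0, ← mul_assoc, mul_inv_mul]
    rfl

/-- A simple infinite Boolean inverse monoid has no atomic idempotents. -/
theorem not_isAtom [Infinite S] (hf : IsFundamental S) (hS : IsZeroSimplifying S)
    (e : Idem S) : ¬ IsAtom e := by
  intro he
  obtain ⟨s, hs, hsup⟩ := exists_ran_sup_eq_top hS he.1
  -- Over an atom the covering ranges are atoms or zero, so an idempotent is determined by those it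
  -- contains. There are then finitely many idempotents, and by fundamentality finitely many
  -- elements.
  have hle : ∀ x y : Idem S, (∀ c ∈ s, ran c ≤ x → ran c ≤ y) → x ≤ y := by
    intro x y h
    rw [← inf_top_eq x, ← hsup, Finset.sup_inf_distrib_left]
    refine Finset.sup_le fun c hc => ?_
    rcases eq_bot_or_eq_ran he (hs c hc) (inf_le_right : x ⊓ ran c ≤ ran c) with h1 | h1
    · rw [h1]; exact bot_le
    · rw [h1]; exact h c hc (inf_eq_right.1 h1)
  have hfinI : Finite (Idem S) := by
    refine Finite.of_injective (fun (x : Idem S) (c : s) => ran c.1 ≤ x) fun x y h => ?_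
    have h' : ∀ c ∈ s, (ran c ≤ x ↔ ran c ≤ y) := fun c hc => by
      simpa using congrFun h ⟨c, hc⟩
    exact le_antisymm (hle x y fun c hc => (h' c hc).1) (hle y x fun c hc => (h' c hc).2)
  have hfin : Finite S := by
    refine Finite.of_injective (fun (x : S) => partialConj x) fun x y h => ?_
    refine eq_of_forall_conj_eq hf fun e he => ?_
    exact congrArg Subtype.val (congrFun h ⟨e, he⟩)
  exact not_finite S

/-- Every nonzero idempotent of a simple infinite Boolean inverse monoid splits. -/
theorem exists_split [Infinite S] (hf : IsFundamental S) (hS : IsZeroSimplifying S)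
    {e : Idem S} (he : e ≠ ⊥) :
    ∃ e₁ e₂ : Idem S, e₁ ≠ ⊥ ∧ e₂ ≠ ⊥ ∧ Disjoint e₁ e₂ ∧ e₁ ⊔ e₂ = e := by
  have := not_isAtom hf hS e
  rw [IsAtom] at this
  push Not at this
  obtain ⟨b, hb, hb0⟩ := this he
  refine ⟨b, e \ b, hb0, ?_, disjoint_sdiff_self_right, sup_sdiff_cancel_right hb.le⟩
  rw [Ne, sdiff_eq_bot_iff]
  exact not_le_of_gt hb

end Idem

/-! ### Supports of units and special involutions -/

namespace Idem

variable {S : Type u} [InverseMonoidWithZero S]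

/-- Conjugation by a unit as an automorphism of the poset of idempotents. -/
def conjIso (g : Sˣ) : Idem S ≃o Idem S where
  toFun := conj g
  invFun := conj g⁻¹
  left_inv := conj_inv_conj g
  right_inv := conj_conj_inv g
  map_rel_iff' := by
    intro e f
    refine ⟨fun h => ?_, fun h => conj_mono g h⟩
    have := conj_mono g⁻¹ h
    simpa only [Equiv.coe_fn_mk, conj_inv_conj] using this

/-- The action of the group of units on the idempotents by conjugation. -/
def conjHom (S : Type u) [InverseMonoidWithZero S] : Sˣ →* (Idem S ≃o Idem S) where
  toFun := conjIso
  map_one' := by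
    refine DFunLike.ext _ _ fun e => Subtype.ext ?_
    change ((1 : Sˣ) : S) * e.1 * ((1⁻¹ : Sˣ) : S) = e.1
    simp
  map_mul' g h := by
    refine DFunLike.ext _ _ fun e => Subtype.ext ?_
    change ((g * h : Sˣ) : S) * e.1 * (((g * h)⁻¹ : Sˣ) : S) =
      (g : S) * ((h : S) * e.1 * ((h⁻¹ : Sˣ) : S)) * ((g⁻¹ : Sˣ) : S)
    simp only [mul_inv_rev, Units.val_mul, mul_assoc]

theorem conj_val (g : Sˣ) (e : Idem S) : (conj g e).1 = (g : S) * e.1 * ((g⁻¹ : Sˣ) : S) := rfl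

theorem conj_eq_of_mul_eq {g : Sˣ} {x : Idem S} (h : (g : S) * x.1 = x.1) : conj g x = x := by
  apply Subtype.ext
  rw [conj_val, h, val_inv]
  have := congrArg (·⁻¹) h
  simpa [inv_mul_rev, inv_of_idem x.mul_self] using this

/-- In a fundamental monoid a unit fixes all idempotents below `e` exactly when it restricts to
the identity on `e`. -/
theorem mul_eq_iff_forall_conj_eq (hf : IsFundamental S) (g : Sˣ) (e : Idem S) :
    (g : S) * e.1 = e.1 ↔ ∀ x ≤ e, conj g x = x := by
  constructor
  · intro h x hx
    apply conj_eq_of_mul_eq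
    have hx' := le_iff'.1 hx
    rw [← hx', ← mul_assoc, h]
  · intro h
    have hcomm : ∀ x ≤ e, (g : S) * x.1 = x.1 * g := by
      intro x hx
      have := congrArg Subtype.val (h x hx)
      rw [conj_val] at this
      conv_rhs => rw [← this]
      simp [mul_assoc]
    -- `g e` commutes with all idempotents, so it is idempotent and equals its own domain `e`.
    have hidem : IsIdempotentElem ((g : S) * e.1) := by
      refine hf _ fun f hff => ?_
      have hef : (⟨e.1 * f, idem_mul_idem e.mul_self hff.eq⟩ : Idem S) ≤ e := by
        refine le_iff'.2 ?_
        change e.1 * (e.1 * f) = e.1 * f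
        rw [← mul_assoc, e.mul_self]
      have h1 : (g : S) * (e.1 * f) = e.1 * f * g := hcomm _ hef
      rw [mul_assoc, h1, idem_comm e.mul_self hff.eq, mul_assoc, hcomm e le_rfl]
    have h2 : ((g : S) * e.1)⁻¹ * ((g : S) * e.1) = e.1 := by
      rw [inv_mul_rev, inv_of_idem e.mul_self, ← val_inv]
      calc e.1 * ((g⁻¹ : Sˣ) : S) * ((g : S) * e.1)
          = e.1 * (((g⁻¹ : Sˣ) : S) * (g : S)) * e.1 := by simp only [mul_assoc]
        _ = e.1 := by rw [Units.inv_mul, mul_one, e.mul_self]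
    rw [inv_of_idem hidem.eq, hidem.eq] at h2
    exact h2

section Tarski

variable [IsTarski S]

/-- Take `m = g ∧ 1`: an idempotent satisfies `g e = e` exactly when it lies below `g`. -/
theorem exists_fixed (g : Sˣ) : ∃ m : Idem S, ∀ e : Idem S, e ≤ m ↔ (g : S) * e.1 = e.1 := by
  obtain ⟨m, hm⟩ := IsTarski.exists_meet (g : S) 1
  refine ⟨⟨m, isIdempotentElem_of_le (mul_one 1) (hm.1 (by simp))⟩, fun e => ?_⟩
  rw [← le_iff_mul_eq e.mul_self]
  change e.1 ≤ m ↔ _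
  constructor
  · intro h
    exact h.trans (hm.1 (by simp))
  · intro h
    refine hm.2 ?_
    simp only [lowerBounds_insert, lowerBounds_singleton, Set.mem_inter_iff, Set.mem_Iic]
    exact ⟨h, le_one_of_idem e.2⟩

/-- The support of a unit: the complement of its meet with the identity. -/
noncomputable def supp (g : Sˣ) : Idem S := (exists_fixed g).chooseᶜ

theorem disjoint_supp_iff (g : Sˣ) (e : Idem S) :
    Disjoint e (supp g) ↔ (g : S) * e.1 = e.1 := by
  rw [supp, disjoint_compl_right_iff]
  exact (exists_fixed g).choose_spec e

theorem eq_one_of_supp_eq_bot {g : Sˣ} (h : supp g = ⊥) : g = 1 := by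
  have := (disjoint_supp_iff g ⊤).1 (by rw [h]; exact disjoint_bot_right)
  rw [coe_top, mul_one] at this
  exact Units.ext this

end Tarski

/-- A nonzero element with orthogonal domain and range extends to a special involution supported
on its extent. -/
theorem exists_isSpecialInvolution [IsBooleanInverse S] {c : S} (hc : c ≠ 0)
    (hd : Disjoint (dom c) (ran c)) :
    ∃ g : Sˣ, IsSpecialInvolution g ∧ g * g = 1 ∧
      ∀ e : Idem S, (g : S) * e.1 = e.1 ↔ Disjoint e (dom c ⊔ ran c) := by
  have hdr : c⁻¹ * c * (c * c⁻¹) = 0 := disjoint_iff_mul.1 hd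
  have hcc : c * c = 0 := by
    calc c * c = c * (c⁻¹ * c * (c * c⁻¹)) * c := by
          conv_lhs => rw [← mul_inv_mul c]
          simp only [mul_assoc]
      _ = 0 := by rw [hdr]; simp
  have hcc' : c⁻¹ * c⁻¹ = 0 := by rw [← inv_mul_rev, hcc, zero_inv_eq]
  set e : Idem S := dom c ⊔ ran c with he
  set k : Idem S := eᶜ with hk
  have hdk : c⁻¹ * c * k.1 = 0 :=
    disjoint_iff_mul.1 (disjoint_compl_right.mono_left (le_sup_left : dom c ≤ e))
  have hrk : c * c⁻¹ * k.1 = 0 :=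
    disjoint_iff_mul.1 (disjoint_compl_right.mono_left (le_sup_right : ran c ≤ e))
  have hck : c * k.1 = 0 := by
    rw [← mul_inv_mul c, mul_assoc c, mul_assoc c, hdk, mul_zero]
  have hck' : c⁻¹ * k.1 = 0 := by
    rw [← inv_mul_inv c, mul_assoc c⁻¹, mul_assoc c⁻¹, hrk, mul_zero]
  have hkk : k.1⁻¹ = k.1 := inv_of_idem k.mul_self
  have hkc : k.1 * c = 0 := by
    have := congrArg (·⁻¹) hck'
    simpa [inv_mul_rev, inv_inv_eq, hkk, zero_inv_eq] using this
  have hkc' : k.1 * c⁻¹ = 0 := by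
    have := congrArg (·⁻¹) hck
    simpa [inv_mul_rev, inv_inv_eq, hkk, zero_inv_eq] using this
  have h00 : IsIdempotentElem (0 : S) := mul_zero 0
  have hcomp : Compatible c⁻¹ c := by
    constructor
    · rw [inv_inv_eq, hcc]; exact h00
    · rw [hcc']; exact h00
  -- `j = c⁻¹ ∨ c` swaps domain and range and squares to the extent `e`; adjoining the complement
  -- `k` turns it into a unit of square `1`.
  obtain ⟨j, hj⟩ := IsBooleanInverse.exists_join _ _ hcomp
  have hjk : j * k.1 = 0 := by
    have := IsBooleanInverse.join_mul _ _ _ k.1 hcomp hj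
    rw [hck, hck'] at this
    exact eq_of_isLUB_pair_zero_right this
  have hkj : k.1 * j = 0 := by
    have := IsBooleanInverse.mul_join _ _ _ k.1 hcomp hj
    rw [hkc, hkc'] at this
    exact eq_of_isLUB_pair_zero_right this
  have hjc : j * c = c⁻¹ * c := by
    have := IsBooleanInverse.join_mul _ _ _ c hcomp hj
    rw [hcc] at this
    exact eq_of_isLUB_pair_zero_right this
  have hjc' : j * c⁻¹ = c * c⁻¹ := by
    have := IsBooleanInverse.join_mul _ _ _ c⁻¹ hcomp hj
    rw [hcc'] at this
    exact eq_of_isLUB_pair_zero_left this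
  have hjj : j * j = e.1 := by
    have := IsBooleanInverse.mul_join _ _ _ j hcomp hj
    rw [hjc, hjc', Set.pair_comm] at this
    exact this.unique (isLUB_sup (dom c) (ran c))
  have hek : IsLUB {e.1, k.1} (1 : S) := by
    have := isLUB_sup e k
    rwa [hk, sup_compl_eq_top, coe_top] at this
  have hje : j * e.1 = j := by
    have h1 := IsBooleanInverse.mul_join _ _ _ j (compatible_of_idem e.mul_self k.mul_self) hek
    rw [hjk, mul_one] at h1
    exact (eq_of_isLUB_pair_zero_right h1).symm
  have hjinv : j⁻¹ = j := by
    have h3 : j * j * j = j := by rw [mul_assoc, hjj, hje]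
    exact (inv_unique j j h3 h3).symm
  have hcomp' : Compatible j k.1 := by
    constructor
    · rw [hjinv, hjk]; exact h00
    · rw [hkk, hjk]; exact h00
  obtain ⟨g, hg⟩ := IsBooleanInverse.exists_join _ _ hcomp'
  have hgj : g * j = e.1 := by
    have := IsBooleanInverse.join_mul _ _ _ j hcomp' hg
    rw [hjj, hkj] at this
    exact eq_of_isLUB_pair_zero_right this
  have hgk : g * k.1 = k.1 := by
    have := IsBooleanInverse.join_mul _ _ _ k.1 hcomp' hg
    rw [hjk, k.mul_self] at this
    exact eq_of_isLUB_pair_zero_left this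
  have hgg : g * g = 1 := by
    have := IsBooleanInverse.mul_join _ _ _ g hcomp' hg
    rw [hgj, hgk] at this
    exact this.unique hek
  have hjg : j ≤ g := hg.1 (by simp)
  have hcj : c ≤ j := hj.1 (by simp)
  have hcj' : c⁻¹ ≤ j := hj.1 (by simp)
  have hgd : g * (c⁻¹ * c) = c := by
    have := le_iff_eq_mul_dom.1 (hcj.trans hjg)
    exact this.symm
  have hgr : g * (c * c⁻¹) = c⁻¹ := by
    have := le_iff_eq_mul_dom.1 (hcj'.trans hjg)
    rw [inv_inv_eq] at this
    exact this.symm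
  have hlub : IsLUB {c⁻¹, c, k.1} g := by
    constructor
    · simp only [upperBounds_insert, upperBounds_singleton, Set.mem_inter_iff, Set.mem_Ici]
      exact ⟨hcj'.trans hjg, hcj.trans hjg, hg.1 (by simp)⟩
    · intro b hb
      simp only [upperBounds_insert, upperBounds_singleton, Set.mem_inter_iff, Set.mem_Ici] at hb
      refine hg.2 ?_
      simp only [upperBounds_insert, upperBounds_singleton, Set.mem_inter_iff, Set.mem_Ici]
      refine ⟨hj.2 ?_, hb.2.2⟩
      simp only [upperBounds_insert, upperBounds_singleton, Set.mem_inter_iff, Set.mem_Ici]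
      exact ⟨hb.1, hb.2.1⟩
  refine ⟨⟨g, g, hgg, hgg⟩, ⟨?_, c, hcc, e, k, ?_, isCompl_compl, hlub⟩, Units.ext hgg, ?_⟩
  · intro h1
    have hg1 : g = 1 := congrArg Units.val h1
    have hc1 : c ≤ 1 := hg1 ▸ hcj.trans hjg
    have := isIdempotentElem_of_le (mul_one 1) hc1
    exact hc (this.eq.symm.trans hcc)
  · exact isLUB_pair
  · intro x
    constructor
    · intro hx
      change g * x.1 = x.1 at hx
      -- `g` fixes this piece and also carries it below the range, which is disjoint from the
      -- domain; so the piece vanishes. Symmetrically for the range.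
      have hx1 : dom c ⊓ x ≤ ran c := by
        rw [← ran_coe (dom c ⊓ x), ran_le_iff]
        have h1 : g * (dom c ⊓ x).1 = (dom c ⊓ x).1 := by
          rw [inf_comm, coe_inf, ← mul_assoc, hx]
        have h2 : g * (dom c ⊓ x).1 = c * x.1 := by
          rw [coe_inf, ← mul_assoc]
          change g * (c⁻¹ * c) * x.1 = _
          rw [hgd]
        rw [← h1, h2, ← mul_assoc]
        change c * c⁻¹ * c * x.1 = _
        rw [mul_inv_mul]
      have hx2 : ran c ⊓ x ≤ dom c := by
        rw [← ran_coe (ran c ⊓ x), ran_le_iff]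
        have h1 : g * (ran c ⊓ x).1 = (ran c ⊓ x).1 := by
          rw [inf_comm, coe_inf, ← mul_assoc, hx]
        have h2 : g * (ran c ⊓ x).1 = c⁻¹ * x.1 := by
          rw [coe_inf, ← mul_assoc]
          change g * (c * c⁻¹) * x.1 = _
          rw [hgr]
        rw [← h1, h2, ← mul_assoc]
        change c⁻¹ * c * c⁻¹ * x.1 = _
        rw [inv_mul_inv]
      rw [he, disjoint_sup_right, disjoint_comm, disjoint_iff, disjoint_comm, disjoint_iff]
      exact ⟨disjoint_self.1 (hd.mono inf_le_left hx1), disjoint_self.1 (hd.mono hx2 inf_le_left)⟩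
    · intro hx
      have hxk : x ≤ k := le_compl_iff_disjoint_right.2 hx
      have := le_iff'.1 hxk
      change g * x.1 = x.1
      rw [← this, ← mul_assoc, hgk]

/-! ### Simple Tarski monoids give supported actions -/

section Simple

variable [IsSimpleTarski S]

instance : Infinite S := IsTarski.infinite

theorem exists_supp_eq {c : S} (hd : Disjoint (dom c) (ran c)) :
    ∃ g ∈ SymGroup S, g * g = 1 ∧ supp g = dom c ⊔ ran c := by
  -- For `c = 0` the construction would give `1`, which is not a special involution but does lie in
  -- `Sym(S)`.
  by_cases hc : c = 0
  · have h1 : supp (1 : Sˣ) = (⊥ : Idem S) :=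
      top_disjoint.1 ((disjoint_supp_iff 1 ⊤).2 (by simp))
    have h2 : dom (0 : S) = ⊥ := Subtype.ext (mul_zero _)
    refine ⟨1, one_mem _, one_mul 1, ?_⟩
    rw [hc, ran_zero, h2, h1, sup_idem]
  · obtain ⟨g, hg, hgg, hfix⟩ := exists_isSpecialInvolution hc hd
    refine ⟨g, Subgroup.subset_closure hg, hgg, ?_⟩
    have : ∀ e : Idem S, Disjoint e (supp g) ↔ Disjoint e (dom c ⊔ ran c) := fun e => by
      rw [disjoint_supp_iff, hfix]
    apply le_antisymm
    · rw [← disjoint_compl_left_iff]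
      exact (this _).2 disjoint_compl_left
    · rw [← disjoint_compl_left_iff]
      exact (this _).1 disjoint_compl_left

/-- Cover `f` by ranges of elements with domain in `e`. The resulting involutions have supports
filling `f`, and only their domains spill over into `e`. -/
theorem exists_finset_supp_between {e f : Idem S} (he : e ≠ ⊥) (hef : Disjoint e f) :
    ∃ t : Finset Sˣ, (∀ g ∈ t, g ∈ SymGroup S ∧ g * g = 1) ∧
      f ≤ t.sup supp ∧ t.sup supp ≤ e ⊔ f := by
  classical
  obtain ⟨s, hs, hsup⟩ := exists_ran_sup_eq (IsSimpleTarski.zeroSimplifying (S := S)) he f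
  have hd : ∀ c ∈ s, Disjoint (dom c) (ran c) := fun c hc => hef.mono (hs c hc).1 (hs c hc).2
  choose! γ hγ using fun (c : S) (h : Disjoint (dom c) (ran c)) => exists_supp_eq h
  refine ⟨s.image γ, ?_, ?_, ?_⟩
  · intro g hg
    obtain ⟨c, hc, rfl⟩ := Finset.mem_image.1 hg
    exact ⟨(hγ c (hd c hc)).1, (hγ c (hd c hc)).2.1⟩
  · rw [Finset.sup_image, ← hsup]
    refine Finset.sup_mono_fun fun c hc => ?_
    rw [Function.comp_apply, (hγ c (hd c hc)).2.2]
    exact le_sup_right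
  · rw [Finset.sup_image]
    refine Finset.sup_le fun c hc => ?_
    rw [Function.comp_apply, (hγ c (hd c hc)).2.2]
    exact sup_le_sup (hs c hc).1 (hs c hc).2

/-- Every idempotent is a finite join of supports of involutions in `Sym(S)`. -/
theorem exists_finset_supp_sup_eq (e : Idem S) :
    ∃ t : Finset Sˣ, (∀ g ∈ t, g ∈ SymGroup S ∧ g * g = 1) ∧ t.sup supp = e := by
  classical
  by_cases he : e = ⊥
  · exact ⟨∅, by simp, by simp [he]⟩
  obtain ⟨e₁, e₂, h₁, h₂, hd, rfl⟩ := exists_split (IsSimpleTarski.fundamental (S := S))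
    (IsSimpleTarski.zeroSimplifying (S := S)) he
  -- Each half is covered from the other, so the spill stays inside `e₁ ⊔ e₂`.
  obtain ⟨t₁, ht₁, hl₁, hu₁⟩ := exists_finset_supp_between h₁ hd
  obtain ⟨t₂, ht₂, hl₂, hu₂⟩ := exists_finset_supp_between h₂ hd.symm
  refine ⟨t₁ ∪ t₂, ?_, ?_⟩
  · intro g hg
    rcases Finset.mem_union.1 hg with h | h
    · exact ht₁ g h
    · exact ht₂ g h
  · rw [Finset.sup_union]
    apply le_antisymm (sup_le hu₁ (by rwa [sup_comm e₁]))
    exact sup_le (hl₂.trans le_sup_right) (hl₁.trans le_sup_left)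

/-- Fundamentality matches the support with the fixed idempotents; the involutions and the
decompositions into supports come from `Sym(S)`, and so are available in `G`. -/
theorem isSupportedAction {G : Subgroup Sˣ} (hG : SymGroup S ≤ G) :
    IsSupportedAction ((conjHom S).comp G.subtype) (fun g : G => supp (g : Sˣ)) where
  fixes_iff g e := by
    rw [disjoint_supp_iff, mul_eq_iff_forall_conj_eq (IsSimpleTarski.fundamental (S := S))]
    rfl
  eq_one g hg := Subtype.ext (eq_one_of_supp_eq_bot hg)
  exists_involution e he := by
    obtain ⟨t, ht, rfl⟩ := exists_finset_supp_sup_eq e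
    obtain ⟨g, hg, hne⟩ : ∃ g ∈ t, supp g ≠ (⊥ : Idem S) := by
      by_contra! h
      exact he ((Finset.sup_eq_bot_iff supp t).2 h)
    refine ⟨⟨g, hG (ht g hg).1⟩, ?_, Subtype.ext (ht g hg).2, Finset.le_sup hg⟩
    intro h1
    apply hne
    have : g = 1 := congrArg Subtype.val h1
    rw [this]
    exact top_disjoint.1 ((disjoint_supp_iff 1 ⊤).2 (by simp))
  exists_sup e := by
    classical
    obtain ⟨t, ht, rfl⟩ := exists_finset_supp_sup_eq e
    refine ⟨t.subtype (· ∈ G), ?_⟩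
    conv_rhs => rw [← Finset.subtype_map_of_mem (fun g hg => hG (ht g hg).1), Finset.sup_map]
    rfl

end Simple

end Idem

/-! ### Passage to ultrafilters -/

namespace StructureSpace

variable {S T : Type*} [InverseMonoidWithZero S] [InverseMonoidWithZero T]

/-- The image of a filter of idempotents under an order isomorphism. -/
def mapFilter (θ : Idem S ≃o Idem T) (F : Order.PFilter (Idem S)) : Order.PFilter (Idem T) :=
  Order.IsPFilter.toPFilter (F := {e | θ.symm e ∈ F}) <|
    Order.IsPFilter.of_def
      (by
        obtain ⟨e, he⟩ := F.nonempty
        exact ⟨θ e, by simpa using he⟩)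
      (by
        intro e he f hf
        obtain ⟨k, hk, hke, hkf⟩ := F.directed _ he _ hf
        exact ⟨θ k, by simpa using hk, (θ.le_symm_apply).1 hke, (θ.le_symm_apply).1 hkf⟩)
      (by
        intro e f hef he
        exact Order.PFilter.mem_of_le (θ.symm.monotone hef) he)

theorem mem_mapFilter {θ : Idem S ≃o Idem T} {F : Order.PFilter (Idem S)} {e : Idem T} :
    e ∈ mapFilter θ F ↔ θ.symm e ∈ F := Iff.rfl

/-- The map of structure spaces induced by an isomorphism of the idempotents. -/
def map (θ : Idem S ≃o Idem T) (F : StructureSpace S) : StructureSpace T :=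
  ⟨mapFilter θ F.1, by
    refine ⟨fun h => F.2.1 ?_, fun A hA hle x hx => ?_⟩
    · rwa [mem_mapFilter, map_bot] at h
    · have h1 : F.1 ≤ mapFilter θ.symm A := fun y hy => by
        refine mem_mapFilter.2 (hle ?_)
        exact mem_mapFilter.2 (by simpa using hy)
      have h2 := F.2.2 (y := mapFilter θ.symm A)
        (fun h => hA (by rw [mem_mapFilter, map_bot] at h; exact h)) h1
      refine mem_mapFilter.2 (h2 (mem_mapFilter.2 ?_))
      simpa using hx⟩

theorem mem_map {θ : Idem S ≃o Idem T} {F : StructureSpace S} {e : Idem T} :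
    e ∈ (map θ F).1 ↔ θ.symm e ∈ F.1 := Iff.rfl

theorem ext_mem {F F' : StructureSpace S} (h : ∀ e, e ∈ F.1 ↔ e ∈ F'.1) : F = F' :=
  Subtype.ext (SetLike.ext h)

theorem continuous_map (θ : Idem S ≃o Idem T) : Continuous (map θ) := by
  refine continuous_generateFrom_iff.2 ?_
  rintro _ ⟨e, rfl⟩
  exact TopologicalSpace.isOpen_generateFrom_of_mem ⟨θ.symm e, rfl⟩

/-- The homeomorphism of structure spaces induced by an isomorphism of the idempotents. -/
def homeomorph (θ : Idem S ≃o Idem T) : StructureSpace S ≃ₜ StructureSpace T where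
  toFun := map θ
  invFun := map θ.symm
  left_inv F := ext_mem fun e => by simp [mem_map]
  right_inv F := ext_mem fun e => by simp [mem_map]
  continuous_toFun := continuous_map θ
  continuous_invFun := continuous_map θ.symm

theorem mem_conj {g : Sˣ} {F : StructureSpace S} {e : Idem S} :
    e ∈ (conj g F).1 ↔ Idem.conj g⁻¹ e ∈ F.1 := by
  change e ∈ Idem.conjFilter g F.1 ↔ _
  rw [Idem.mem_conjFilter]
  constructor
  · rintro ⟨f, hf, rfl⟩
    rwa [Idem.conj_inv_conj]
  · intro h
    exact ⟨_, h, Idem.conj_conj_inv g e⟩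

theorem map_conj {θ : Idem S ≃o Idem T} {g : Sˣ} {h : Tˣ}
    (hθ : ∀ e, θ (Idem.conj g e) = Idem.conj h (θ e)) (F : StructureSpace S) :
    map θ (conj g F) = conj h (map θ F) := by
  refine ext_mem fun e => ?_
  rw [mem_map, mem_conj, mem_conj, mem_map]
  have : Idem.conj g⁻¹ (θ.symm e) = θ.symm (Idem.conj h⁻¹ e) := by
    apply θ.injective
    have := hθ (Idem.conj g⁻¹ (θ.symm e))
    rw [Idem.conj_conj_inv, θ.apply_symm_apply] at this
    rw [θ.apply_symm_apply]
    conv_rhs => rw [this]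
    rw [Idem.conj_inv_conj]
  rw [this]

end StructureSpace

theorem mainTheorem2 {S : Type*} {T : Type*}
    [InverseMonoidWithZero S] [InverseMonoidWithZero T]
    [IsSimpleTarski S] [IsSimpleTarski T]
    (G : Subgroup Sˣ) (H : Subgroup Tˣ)
    (hG : SymGroup S ≤ G) (hH : SymGroup T ≤ H) (α : G ≃* H) :
    ∃ β : StructureSpace S ≃ₜ StructureSpace T,
      ∀ (g : G) (F : StructureSpace S),
        β (StructureSpace.conj (g : Sˣ) F) = StructureSpace.conj (α g : Tˣ) (β F) := by
  obtain ⟨θ, hθ⟩ := (Idem.isSupportedAction hG).exists_orderIso (Idem.isSupportedAction hH) α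
  exact ⟨StructureSpace.homeomorph θ, fun g F => StructureSpace.map_conj (hθ g) F⟩
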